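/- Let $M$ be a connected oriented smooth surface without boundary, let $\nabla$ be a smooth torsion-free connection on $TM$, and let $[g]$ be a conformal structure on $M$, i.e. an equivalence class of smooth Riemannian metrics, where $g\sim e^{2u}g$ for $u\in C^\infty(M)$. Let $J$ be the complex structure on $TM$ given by counter-clockwise rotation by $\pi/2$ with respect to $[g]$, and let $K$ be its canonical bundle; thus $\overline{K}^{-1}$ is the bundle $T^{0,1}M\subset TM\otimes\mathbb C$, and a section $\Phi$ of $K^2\otimes\overline{K}^{-1}$ is a field of $J$-complex-bilinear maps $T_xM\times T_xM\to T^{0,1}_xM$, whose real part $\operatorname{Re}\Phi$ is a $1$-form with values in $\operatorname{End}(TM)$. For a $1$-form $\theta$ write $\operatorname{Sym}(\theta)(v_1,v_2)=\theta(v_1)v_2+\theta(v_2)v_1$. A Weyl connection for $[g]$ is a smooth connection of the form ${}^{g}\nabla+g\otimes\theta^\sharp-\operatorname{Sym}(\theta)$ with $g\in[g]$, ${}^g\nabla$ its Levi-Civita connection and $\theta$ a smooth $1$-form. Two connections are projectively equivalent if they have the same unparametrised geodesics, that is, the same smooth immersed curves $\gamma$ for which the covariant derivative of $\dot\gamma$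 along $\gamma$ equals $f\dot\gamma$ for some function $f$. (i) There are a unique Weyl connection $D$ for $[g]$ and a unique smooth section $\Phi$ of $K^2\otimes\overline{K}^{-1}$ such that $D+\operatorname{Re}\Phi$ is projectively equivalent to $\nabla$. (ii) For every metric $g\in[g]$ there are a unique smooth $1$-form $\theta$ and a unique cubic differential $A$ (smooth section of $K^3$) such that ${}^{g}\nabla+g\otimes\theta^\sharp-\operatorname{Sym}(\theta)+B$ is projectively equivalent to $\nabla$, where $B$ is the $\operatorname{End}(TM)$-valued $1$-form with $g(B(v_1)v_2,v_3)=\operatorname{Re}A(v_1,v_2,v_3)$. Moreover $D={}^{g}\nabla+g\otimes\theta^\sharp-\operatorname{Sym}(\theta)$ and $\operatorname{Re}\Phi=B$. (iii) If $g\in[g]$ is replaced by $e^{2u}g$ with $u\in C^\infty(M)$, then the pair $(A,\theta)$ of (ii) is replaced by $(e^{2u}A,\ \theta+du)$. -/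

import Mathlib

open Bundle Module
open scoped Manifold ContDiff Topology TensorProduct

noncomputable section

namespace WeylProjective

/-- The model plane `ℝ²`. -/
abbrev Plane : Type := EuclideanSpace ℝ (Fin 2)

section Linear

/-- Rotation by a right angle in an oriented plane is unchanged under a similarity. -/
theorem rightAngleRotation_of_similarity {V W : Type*}
    [NormedAddCommGroup V] [InnerProductSpace ℝ V] [Fact (finrank ℝ V = 2)]
    [NormedAddCommGroup W] [InnerProductSpace ℝ W] [Fact (finrank ℝ W = 2)]
    (o : Orientation ℝ V (Fin 2)) (f : V ≃ₗ[ℝ] W) (r : ℝ) (hr : 0 < r)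
    (hf : ∀ v w : V, inner ℝ (f v) (f w) = r ^ 2 * inner ℝ v w) (v : V) :
    (Orientation.map (Fin 2) f o).rightAngleRotation (f v) = f (o.rightAngleRotation v) := by
  have hr0 : r⁻¹ ≠ 0 := inv_ne_zero hr.ne'
  let s : W ≃ₗ[ℝ] W := LinearEquiv.smulOfNeZero ℝ W r⁻¹ hr0
  let φ : V ≃ₗᵢ[ℝ] W := LinearEquiv.isometryOfInner (f.trans s) (by
    intro a b
    simp only [s, LinearEquiv.trans_apply, LinearEquiv.smulOfNeZero_apply, inner_smul_left,
      inner_smul_right, hf]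
    simp only [conj_trivial]
    field_simp)
  have hφ : ∀ a, φ a = r⁻¹ • f a := fun a => rfl
  have hfd : FiniteDimensional ℝ W := FiniteDimensional.of_fact_finrank_eq_two
  have ho : Orientation.map (Fin 2) φ.toLinearEquiv o = Orientation.map (Fin 2) f o := by
    have hd : 0 < LinearMap.det (s : W →ₗ[ℝ] W) := by
      have : (s : W →ₗ[ℝ] W) = r⁻¹ • LinearMap.id := by ext; rfl
      rw [this, LinearMap.det_smul]
      simp only [LinearMap.det_id, mul_one]
      positivity
    have h2 : Orientation.map (Fin 2) φ.toLinearEquiv o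
        = Orientation.map (Fin 2) s (Orientation.map (Fin 2) f o) := by
      induction o using Module.Ray.ind with
      | h w hw => rfl
    rw [h2, Orientation.map_eq_iff_det_pos _ _ (by simp [Fact.out (p := finrank ℝ W = 2)])]
    exact hd
  have key := o.rightAngleRotation_map φ (f v)
  rw [ho] at key
  rw [key]
  have e1 : φ.symm (f v) = r • v := by
    rw [LinearIsometryEquiv.symm_apply_eq, hφ, map_smul, smul_smul, inv_mul_cancel₀ hr.ne',
      one_smul]
  rw [e1, hφ, map_smul, map_smul, smul_smul, inv_mul_cancel₀ hr.ne', one_smul]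

end Linear

section Complexification

variable {V : Type*} [AddCommGroup V] [Module ℝ V]

/-- Real part of a vector of the complexification: `z ⊗ v ↦ (Re z) v`. -/
def rePart : (ℂ ⊗[ℝ] V) →ₗ[ℝ] V :=
  (TensorProduct.lid ℝ V).toLinearMap ∘ₗ LinearMap.rTensor V Complex.reLm

/-- Imaginary part of a vector of the complexification: `z ⊗ v ↦ (Im z) v`. -/
def imPart : (ℂ ⊗[ℝ] V) →ₗ[ℝ] V :=
  (TensorProduct.lid ℝ V).toLinearMap ∘ₗ LinearMap.rTensor V Complex.imLm

end Complexification

variable {M : Type*} [TopologicalSpace M] [ChartedSpace Plane M] [IsManifold (𝓡 2) ∞ M]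

variable (M) in
/-- Smooth Riemannian metrics on the surface `M`. -/
abbrev Metric : Type _ :=
  ContMDiffRiemannianMetric (𝓡 2) ∞ Plane (fun x : M => TangentSpace (𝓡 2) x)

variable (M) in
/-- Covariant derivatives on the tangent bundle `TM`. -/
abbrev Connection : Type _ :=
  CovariantDerivative (𝓡 2) Plane (fun x : M => TangentSpace (𝓡 2) x)

instance finrankTangent (x : M) : Fact (finrank ℝ (TangentSpace (𝓡 2) x) = 2) :=
  ⟨by change finrank ℝ (EuclideanSpace ℝ (Fin 2)) = 2; simp⟩

instance finiteDimensionalTangent (x : M) : FiniteDimensional ℝ (TangentSpace (𝓡 2) x) :=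
  inferInstanceAs (FiniteDimensional ℝ (EuclideanSpace ℝ (Fin 2)))

instance t2Tangent (x : M) : T2Space (TangentSpace (𝓡 2) x) :=
  inferInstanceAs (T2Space (EuclideanSpace ℝ (Fin 2)))

/-- The vector field `X` is smooth at `x₀`. -/
def SmoothFieldAt (X : (x : M) → TangentSpace (𝓡 2) x) (x₀ : M) : Prop :=
  ContMDiffAt (𝓡 2) ((𝓡 2).prod 𝓘(ℝ, Plane)) ∞
    (fun x => TotalSpace.mk' Plane (E := fun x : M => TangentSpace (𝓡 2) x) x (X x)) x₀

/-- The vector field `X` on `M` is smooth. -/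
def SmoothField (X : (x : M) → TangentSpace (𝓡 2) x) : Prop :=
  ContMDiff (𝓡 2) ((𝓡 2).prod 𝓘(ℝ, Plane)) ∞
    (fun x => TotalSpace.mk' Plane (E := fun x : M => TangentSpace (𝓡 2) x) x (X x))

/-- The vector field `X` is differentiable at `x₀`. -/
def DifferentiableFieldAt (X : (x : M) → TangentSpace (𝓡 2) x) (x₀ : M) : Prop :=
  MDifferentiableAt (𝓡 2) ((𝓡 2).prod 𝓘(ℝ, Plane))
    (fun x => TotalSpace.mk' Plane (E := fun x : M => TangentSpace (𝓡 2) x) x (X x)) x₀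

/-- The function `f` on `M`, with values in a real normed space, is smooth. -/
def SmoothFun {F : Type*} [NormedAddCommGroup F] [NormedSpace ℝ F] (f : M → F) : Prop :=
  ContMDiff (𝓡 2) 𝓘(ℝ, F) ∞ f

/-- An orientation of the surface `M`: an orientation of every tangent plane which near every point
is the one given by a smooth local frame `(X, Y)`. -/
structure SurfaceOrientation (M : Type*) [TopologicalSpace M] [ChartedSpace Plane M]
    [IsManifold (𝓡 2) ∞ M] where
  /-- The orientation of the tangent plane at `x`. -/
  orient (x : M) : Orientation ℝ (TangentSpace (𝓡 2) x) (Fin 2)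
  exists_frame (x₀ : M) : ∃ X Y : (x : M) → TangentSpace (𝓡 2) x,
    SmoothFieldAt X x₀ ∧ SmoothFieldAt Y x₀ ∧
    ∀ᶠ x in 𝓝 x₀, ∃ b : Basis (Fin 2) ℝ (TangentSpace (𝓡 2) x),
      b 0 = X x ∧ b 1 = Y x ∧ b.orientation = orient x

/-- `ĝ = e^{2u} g`. -/
def IsConformalChange (g ghat : Metric M) (u : M → ℝ) : Prop :=
  ∀ (x : M) (v w : TangentSpace (𝓡 2) x),
    ghat.inner x v w = Real.exp (2 * u x) * g.inner x v w

variable (M) in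
/-- Two metrics are conformally equivalent if one is `e^{2u}` times the other, `u` smooth. -/
def conformalSetoid : Setoid (Metric M) where
  r g ghat := ∃ u : M → ℝ, SmoothFun u ∧ IsConformalChange g ghat u
  iseqv :=
    { refl := fun g => ⟨fun _ => 0, contMDiff_const, fun x v w => by simp⟩
      symm := by
        rintro g h ⟨u, hu, H⟩
        refine ⟨fun x => -u x, hu.neg, fun x v w => ?_⟩
        rw [H, ← mul_assoc, ← Real.exp_add]
        ring_nf
        simp
      trans := by
        rintro g h k ⟨u, hu, H⟩ ⟨w, hw, K⟩
        refine ⟨fun x => u x + w x, hu.add hw, fun x a b => ?_⟩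
        rw [K, H, ← mul_assoc, ← Real.exp_add]
        ring_nf }

variable (M) in
/-- A conformal structure `[g]` on `M`: a conformal equivalence class of Riemannian metrics. -/
abbrev ConformalStructure : Type _ := Quotient (conformalSetoid M)

/-- The conformal structure `[g]` of the metric `g`. -/
def conformalClass (g : Metric M) : ConformalStructure M := Quotient.mk (conformalSetoid M) g

/-- Counter-clockwise rotation by a right angle with respect to `g` and the orientation. -/
def rotation (o : SurfaceOrientation M) (g : Metric M) (x : M) :
    TangentSpace (𝓡 2) x →ₗ[ℝ] TangentSpace (𝓡 2) x :=
  letI : RiemannianBundle (fun x : M => TangentSpace (𝓡 2) x) := ⟨g.toRiemannianMetric⟩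
  (o.orient x).rightAngleRotation.toLinearEquiv.toLinearMap

theorem rotation_eq_of_conformal (o : SurfaceOrientation M) {g h : Metric M} {u : M → ℝ}
    (H : IsConformalChange g h u) : rotation o g = rotation o h := by
  funext x
  ext v
  let G (k : Metric M) : (i : NormedAddCommGroup (TangentSpace (𝓡 2) x)) ×'
      @InnerProductSpace ℝ (TangentSpace (𝓡 2) x) _ i.toSeminormedAddCommGroup :=
    letI : RiemannianBundle (fun x : M => TangentSpace (𝓡 2) x) := ⟨k.toRiemannianMetric⟩
    ⟨inferInstance, inferInstance⟩
  have key := @rightAngleRotation_of_similarity (TangentSpace (𝓡 2) x) (TangentSpace (𝓡 2) x)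
    (G g).1 (G g).2 (finrankTangent x) (G h).1 (G h).2
    (finrankTangent x) (o.orient x) (LinearEquiv.refl ℝ _) (Real.exp (u x)) (Real.exp_pos _)
    (by
      intro a b
      have := H x a b
      rw [← Real.exp_nat_mul]
      exact_mod_cast this) v
  rw [Orientation.map_refl] at key
  exact key.symm

/-- The complex structure `J` on `TM` defined by the orientation and a conformal structure:
counter-clockwise rotation by a right angle with respect to any metric of the class. -/
def complexStructure (o : SurfaceOrientation M) (c : ConformalStructure M) (x : M) :
    TangentSpace (𝓡 2) x →ₗ[ℝ] TangentSpace (𝓡 2) x :=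
  Quotient.lift (s := conformalSetoid M) (fun g => rotation o g)
    (fun _ _ h => h.elim fun _ H => rotation_eq_of_conformal o H.2) c x

variable (M) in
/-- Smooth real `1`-forms on `M`. -/
@[ext]
structure OneForm where
  /-- The value of the form at a point. -/
  toFun (x : M) : TangentSpace (𝓡 2) x →ₗ[ℝ] ℝ
  smooth (X : (x : M) → TangentSpace (𝓡 2) x) (hX : SmoothField X) :
    SmoothFun (fun x => toFun x (X x))

/-- Cubic differentials: smooth sections of `K³`, where `K` is the canonical bundle of the
complex structure `J`. The fibre of `K³` at `x` is the space of complex trilinear maps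
`(T_x M, J)³ → ℂ`. -/
@[ext]
structure CubicDifferential (o : SurfaceOrientation M) (c : ConformalStructure M) where
  /-- The value of the differential at a point. -/
  toFun (x : M) : TangentSpace (𝓡 2) x →ₗ[ℝ] TangentSpace (𝓡 2) x →ₗ[ℝ]
    TangentSpace (𝓡 2) x →ₗ[ℝ] ℂ
  linear₁ (x : M) (v₁ v₂ v₃ : TangentSpace (𝓡 2) x) :
    toFun x (complexStructure o c x v₁) v₂ v₃ = Complex.I * toFun x v₁ v₂ v₃
  linear₂ (x : M) (v₁ v₂ v₃ : TangentSpace (𝓡 2) x) :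
    toFun x v₁ (complexStructure o c x v₂) v₃ = Complex.I * toFun x v₁ v₂ v₃
  linear₃ (x : M) (v₁ v₂ v₃ : TangentSpace (𝓡 2) x) :
    toFun x v₁ v₂ (complexStructure o c x v₃) = Complex.I * toFun x v₁ v₂ v₃
  smooth (X Y Z : (x : M) → TangentSpace (𝓡 2) x)
    (hX : SmoothField X) (hY : SmoothField Y) (hZ : SmoothField Z) :
    SmoothFun (fun x => toFun x (X x) (Y x) (Z x))

/-- Smooth sections of `K² ⊗ K̄⁻¹`. The bundle `K̄⁻¹` is the antiholomorphic tangent bundle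
`T^{0,1}M = {ξ ∈ ℂ ⊗ TM : J ξ = -i ξ}`, and the fibre of `K² ⊗ K̄⁻¹` at `x` is the space of complex
bilinear maps `(T_x M, J)² → T_x^{0,1}M`. -/
@[ext]
structure SectionK2KbarInv (o : SurfaceOrientation M) (c : ConformalStructure M) where
  /-- The value of the section at a point. -/
  toFun (x : M) : TangentSpace (𝓡 2) x →ₗ[ℝ] TangentSpace (𝓡 2) x →ₗ[ℝ]
    (ℂ ⊗[ℝ] TangentSpace (𝓡 2) x)
  linear₁ (x : M) (v₁ v₂ : TangentSpace (𝓡 2) x) :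
    toFun x (complexStructure o c x v₁) v₂ = Complex.I • toFun x v₁ v₂
  linear₂ (x : M) (v₁ v₂ : TangentSpace (𝓡 2) x) :
    toFun x v₁ (complexStructure o c x v₂) = Complex.I • toFun x v₁ v₂
  antiholomorphic (x : M) (v₁ v₂ : TangentSpace (𝓡 2) x) :
    LinearMap.lTensor ℂ (complexStructure o c x) (toFun x v₁ v₂) = -(Complex.I • toFun x v₁ v₂)
  smooth_re (X Y : (x : M) → TangentSpace (𝓡 2) x)
    (hX : SmoothField X) (hY : SmoothField Y) :
    SmoothField (fun x => rePart (toFun x (X x) (Y x)))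
  smooth_im (X Y : (x : M) → TangentSpace (𝓡 2) x)
    (hX : SmoothField X) (hY : SmoothField Y) :
    SmoothField (fun x => imPart (toFun x (X x) (Y x)))

variable (M) in
/-- Fields of bilinear maps `T_x M × T_x M → T_x M`, i.e. `1`-forms `v₁ ↦ B(v₁)` with values in the
endomorphisms of `TM`. -/
abbrev EndForm : Type _ :=
  (x : M) → TangentSpace (𝓡 2) x →ₗ[ℝ] TangentSpace (𝓡 2) x →ₗ[ℝ] TangentSpace (𝓡 2) x

/-- The real part `Re Φ`. -/
def SectionK2KbarInv.re {o : SurfaceOrientation M} {c : ConformalStructure M}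
    (Φ : SectionK2KbarInv o c) : EndForm M :=
  fun x => (Φ.toFun x).compr₂ rePart

/-- The connection `D + B`, that is `(D + B)_X Y = D_X Y + B(X) Y`. -/
def addEndForm (D : Connection M) (B : EndForm M) : Connection M :=
  D.addOneForm fun x => (B x).flip.toContinuousBilinearMap

/-- The connection is smooth. -/
def IsSmooth (D : Connection M) : Prop := CovariantDerivative.ContMDiffCovariantDerivative D ∞

/-- Two connections agree. (Values on vector fields that are not differentiable at the point carry
no meaning.) -/
def SameConnection (D D' : Connection M) : Prop :=
  ∀ (Y : (x : M) → TangentSpace (𝓡 2) x) (x : M), DifferentiableFieldAt Y x → D Y x = D' Y x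

/-- `D` is the Levi-Civita connection of `g`: it is torsion-free and metric. -/
def IsLeviCivita (g : Metric M) (D : Connection M) : Prop :=
  letI : RiemannianBundle (fun x : M => TangentSpace (𝓡 2) x) := ⟨g.toRiemannianMetric⟩
  D.torsion = 0 ∧ D.IsMetricCompatible

/-- The isomorphism `T_x M ≃ T_x^* M`, `v ↦ g(v, ·)`. -/
def flat (g : Metric M) (x : M) :
    TangentSpace (𝓡 2) x ≃ₗ[ℝ] Dual ℝ (TangentSpace (𝓡 2) x) :=
  LinearMap.linearEquivOfInjective
    (LinearMap.mk₂ ℝ (fun v w => g.inner x v w) (by simp) (by simp) (by simp) (by simp))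
    (by
      rw [← LinearMap.ker_eq_bot, LinearMap.ker_eq_bot']
      intro v hv
      by_contra h
      exact (g.pos x v h).ne' (LinearMap.congr_fun hv v))
    Subspace.dual_finrank_eq.symm

/-- The vector `η^♯` with `g(η^♯, ·) = η`. -/
def sharp (g : Metric M) (x : M) (η : TangentSpace (𝓡 2) x →ₗ[ℝ] ℝ) : TangentSpace (𝓡 2) x :=
  (flat g x).symm η

theorem inner_sharp (g : Metric M) (x : M) (η : TangentSpace (𝓡 2) x →ₗ[ℝ] ℝ)
    (w : TangentSpace (𝓡 2) x) : g.inner x (sharp g x η) w = η w :=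
  LinearMap.congr_fun ((flat g x).apply_symm_apply η) w

/-- The tensor `g ⊗ θ^♯ - Sym(θ)`, where `Sym(θ)(v₁, v₂) = θ(v₁) v₂ + θ(v₂) v₁`. -/
def weylTensor (g : Metric M) (θ : OneForm M) : EndForm M := fun x =>
  LinearMap.mk₂ ℝ
    (fun v₁ v₂ => g.inner x v₁ v₂ • sharp g x (θ.toFun x)
      - (θ.toFun x v₁ • v₂ + θ.toFun x v₂ • v₁))
    (by intros; simp; module) (by intros; simp; module)
    (by intros; simp; module) (by intros; simp; module)

/-- The `End(TM)`-valued `1`-form `B` with `g(B(v₁) v₂, v₃) = Re A(v₁, v₂, v₃)`. -/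
def cubicEndForm {o : SurfaceOrientation M} {c : ConformalStructure M} (g : Metric M)
    (A : CubicDifferential o c) : EndForm M := fun x =>
  (A.toFun x).compr₂ ((flat g x).symm.toLinearMap ∘ₗ LinearMap.compRight ℝ Complex.reLm)

theorem inner_cubicEndForm {o : SurfaceOrientation M} {c : ConformalStructure M} (g : Metric M)
    (A : CubicDifferential o c) (x : M) (v₁ v₂ v₃ : TangentSpace (𝓡 2) x) :
    g.inner x (cubicEndForm g A x v₁ v₂) v₃ = (A.toFun x v₁ v₂ v₃).re :=
  inner_sharp g x (Complex.reLm ∘ₗ A.toFun x v₁ v₂) v₃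

/-- `D` is the connection `^g∇ + g ⊗ θ^♯ - Sym(θ)`. -/
def IsWeylConnectionOf (g : Metric M) (θ : OneForm M) (D : Connection M) : Prop :=
  ∃ L : Connection M, IsLeviCivita g L ∧ SameConnection D (addEndForm L (weylTensor g θ))

/-- `D` is a (smooth) Weyl connection for the conformal structure `c`: it is of the form
`^g∇ + g ⊗ θ^♯ - Sym(θ)` for some metric `g` in `c` and some `1`-form `θ`. -/
def IsWeylConnection (c : ConformalStructure M) (D : Connection M) : Prop :=
  IsSmooth D ∧ ∃ g : Metric M, conformalClass g = c ∧ ∃ θ : OneForm M, IsWeylConnectionOf g θ D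

/-- The velocity `γ'(t)`. -/
def velocity (γ : ℝ → M) (t : ℝ) : TangentSpace (𝓡 2) (γ t) :=
  mfderiv 𝓘(ℝ, ℝ) (𝓡 2) γ t (1 : ℝ)

/-- The covariant acceleration `D_{γ'} γ'` at time `t`. In the coordinates of the preferred chart
at `γ(t)`, in which `T_{γ(t)} M` is identified with the model plane and `extend v` is the vector
field with constant components `v`, it is `γ'' + D_v (extend v)` with `v = γ'(t)`. -/
def acceleration (D : Connection M) (γ : ℝ → M) (t : ℝ) : TangentSpace (𝓡 2) (γ t) :=
  (show TangentSpace (𝓡 2) (γ t) from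
    deriv (deriv fun s => extChartAt (𝓡 2) (γ t) (γ s)) t) +
  D (FiberBundle.extend Plane (velocity γ t)) (γ t) (velocity γ t)

/-- The curve `γ`, on the interval `(a, b)`, is an unparametrised geodesic of `D`: a smooth
immersed curve with `D_{γ'} γ' = f γ'` for some function `f`. -/
def IsUnparametrizedGeodesic (D : Connection M) (γ : ℝ → M) (a b : ℝ) : Prop :=
  ContMDiffOn 𝓘(ℝ, ℝ) (𝓡 2) ∞ γ (Set.Ioo a b) ∧
  (∀ t ∈ Set.Ioo a b, velocity γ t ≠ 0) ∧
  ∃ f : ℝ → ℝ, ∀ t ∈ Set.Ioo a b, acceleration D γ t = f t • velocity γ t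

/-- Two connections are projectively equivalent if they have the same unparametrised geodesics. -/
def ProjectivelyEquivalent (D D' : Connection M) : Prop :=
  ∀ (γ : ℝ → M) (a b : ℝ),
    IsUnparametrizedGeodesic D γ a b ↔ IsUnparametrizedGeodesic D' γ a b

/-- The pair `(θ, A)` represents the projective structure of `nabla` with respect to the metric
`g`: the connection `^g∇ + g ⊗ θ^♯ - Sym(θ) + B`, where `g(B(v₁) v₂, v₃) = Re A(v₁, v₂, v₃)`, is
projectively equivalent to `nabla`. -/
def Represents {o : SurfaceOrientation M} {c : ConformalStructure M} (nabla : Connection M)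
    (g : Metric M) (θ : OneForm M) (A : CubicDifferential o c) : Prop :=
  ∃ L : Connection M, IsLeviCivita g L ∧
    ProjectivelyEquivalent (addEndForm (addEndForm L (weylTensor g θ)) (cubicEndForm g A)) nabla

end WeylProjective

end

open WeylProjective

open Bundle Module
open scoped Manifold ContDiff Topology TensorProduct

noncomputable section

namespace WeylProjective

/-! Everything reduces to linear algebra in one tangent plane. Two connections are projectively
equivalent exactly when their difference `E` satisfies `E(v, v) ∥ v` for all `v`, that is `g(Jv,
E(v, v)) = 0`. Write the Levi-Civita connection of `g` as `∇ + S`. For the Weyl connection of `(g,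
θ)` plus a tensor `B`, this condition becomes `g(v, v) θ(Jv) + g(Jv, B(v, v)) = -g(Jv, S(v, v))`
(`projectivelyEquivalent_iff`).

The right side is an arbitrary cubic form on a plane. If `B` is `J`-antilinear in both arguments,
the left side is the decomposition of a cubic form into `g` times a linear form and the real part of
a complex cubic form; the dimensions are `4 = 2 + 2`. Uniqueness is `eq_zero_of_cubic_add_linear`.
Existence is `inner_weylPart_add_cubicPart`, whose explicit formulas also show that `θ` and `B` are
smooth. Such `B` correspond both to sections `Φ` of `K² ⊗ K̄⁻¹`, through `B = Re Φ`, and to cubic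
differentials, through `g(B(v₁)v₂, v₃) = Re A`.

The analytic input is that every nonzero tangent vector is the velocity of some unparametrised
geodesic (`exists_isUnparametrizedGeodesic`); without it, equality of geodesics would give no
pointwise information.

For the dependence on the metric, the Levi-Civita connection of `e^{2u}g` is `^g∇ - g ⊗ (du)^♯ +
Sym(du)`, while `g ⊗ θ^♯` is conformally invariant. Hence a Weyl connection with form `θ̂` for
`e^{2u}g` has form `θ̂ - du` for `g`, and uniqueness for `g` yields both transformation rules. -/

variable {M : Type*} [TopologicalSpace M] [ChartedSpace Plane M] [IsManifold (𝓡 2) ∞ M]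

/-! ### Metric and rotation in one tangent plane -/

section MetricAlgebra

variable (o : SurfaceOrientation M) (g : Metric M) (x : M)

theorem rotation_rotation (v : TangentSpace (𝓡 2) x) :
    rotation o g x (rotation o g x v) = -v := by
  let _ : RiemannianBundle (fun x : M => TangentSpace (𝓡 2) x) := ⟨g.toRiemannianMetric⟩
  exact (o.orient x).rightAngleRotation_rightAngleRotation v

theorem inner_rotation_rotation (v w : TangentSpace (𝓡 2) x) :
    g.inner x (rotation o g x v) (rotation o g x w) = g.inner x v w := by
  let _ : RiemannianBundle (fun x : M => TangentSpace (𝓡 2) x) := ⟨g.toRiemannianMetric⟩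
  exact (o.orient x).inner_comp_rightAngleRotation v w

theorem inner_rotation_left (v w : TangentSpace (𝓡 2) x) :
    g.inner x (rotation o g x v) w = -g.inner x v (rotation o g x w) := by
  rw [← inner_rotation_rotation o g x v, rotation_rotation]
  simp

theorem inner_rotation_self (v : TangentSpace (𝓡 2) x) :
    g.inner x (rotation o g x v) v = 0 := by
  have h := inner_rotation_left o g x v v
  rw [g.symm x v] at h
  linarith

theorem inner_self_rotation (v : TangentSpace (𝓡 2) x) :
    g.inner x v (rotation o g x v) = 0 := by
  rw [g.symm, inner_rotation_self]

variable {g x} in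
theorem eq_of_inner_eq {v w : TangentSpace (𝓡 2) x}
    (h : ∀ z, g.inner x v z = g.inner x w z) : v = w := by
  by_contra hne
  refine (g.pos x (v - w) (sub_ne_zero.2 hne)).ne' ?_
  simp [h]

variable {g x} in
theorem eq_sharp_iff {v : TangentSpace (𝓡 2) x} {η : TangentSpace (𝓡 2) x →ₗ[ℝ] ℝ} :
    v = sharp g x η ↔ ∀ z, g.inner x v z = η z :=
  ⟨fun h z => by rw [h, inner_sharp], fun h => eq_of_inner_eq (g := g) fun z => by
    rw [h, inner_sharp]⟩

/-- The vectors `u` and `Ju` are orthogonal of equal length, so this is the orthogonal expansion of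
`v`, with the denominator cleared so that `u = 0` is allowed. -/
theorem inner_self_smul_eq (u v : TangentSpace (𝓡 2) x) :
    g.inner x u u • v = g.inner x u v • u +
      g.inner x (rotation o g x u) v • rotation o g x u := by
  refine eq_of_inner_eq (g := g) fun z => ?_
  have key : g.inner x u v * g.inner x u z +
      g.inner x (rotation o g x u) v * g.inner x (rotation o g x u) z =
      g.inner x u u * g.inner x v z := by
    let _ : RiemannianBundle (fun x : M => TangentSpace (𝓡 2) x) := ⟨g.toRiemannianMetric⟩
    have h := (o.orient x).inner_mul_inner_add_areaForm_mul_areaForm u v z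
    rw [← (o.orient x).inner_rightAngleRotation_left, ← (o.orient x).inner_rightAngleRotation_left,
      ← real_inner_self_eq_norm_sq] at h
    exact h
  simp only [map_add, map_smul, _root_.add_apply, _root_.smul_apply,
    smul_eq_mul]
  linarith

/-- Coordinates in the frame `(u, Ju)`. -/
theorem exists_coords {u : TangentSpace (𝓡 2) x} (hu : u ≠ 0) (v : TangentSpace (𝓡 2) x) :
    ∃ a b : ℝ, v = a • u + b • rotation o g x u := by
  have hpos := (g.pos x u hu).ne'
  refine ⟨g.inner x u v / g.inner x u u, g.inner x (rotation o g x u) v / g.inner x u u, ?_⟩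
  have h := congrArg (fun z => (g.inner x u u)⁻¹ • z) (inner_self_smul_eq o g x u v)
  simp only [smul_smul, smul_add, inv_mul_cancel₀ hpos, one_smul] at h
  refine h.trans ?_
  congr 2 <;> ring

theorem exists_ne_zero : ∃ u : TangentSpace (𝓡 2) x, u ≠ 0 := by
  have : Nontrivial (TangentSpace (𝓡 2) x) :=
    Module.nontrivial_of_finrank_pos (R := ℝ) (by rw [(finrankTangent x).out]; norm_num)
  exact exists_ne 0

/-- The vector `w` is a multiple of `u` as soon as it is orthogonal to `Ju`. -/
theorem exists_smul_of_inner_rotation {u w : TangentSpace (𝓡 2) x} (hu : u ≠ 0)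
    (h : g.inner x (rotation o g x u) w = 0) : ∃ r : ℝ, w = r • u := by
  have hpos := (g.pos x u hu).ne'
  refine ⟨g.inner x u w / g.inner x u u, ?_⟩
  have h' := congrArg (fun z => (g.inner x u u)⁻¹ • z) (inner_self_smul_eq o g x u w)
  simp only [h, smul_smul, inv_mul_cancel₀ hpos, one_smul, zero_smul, add_zero] at h'
  refine h'.trans ?_
  congr 1; ring

end MetricAlgebra

/-! ### Decomposition of cubic forms on a plane -/

section CubicType

/-- Fields of bilinear maps whose value at every point is `J`-antilinear into `TM` in both
arguments: real parts of sections of `K² ⊗ K̄⁻¹`. -/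
structure IsCubicTypeAt (o : SurfaceOrientation M) (g : Metric M) (x : M)
    (B : TangentSpace (𝓡 2) x →ₗ[ℝ] TangentSpace (𝓡 2) x →ₗ[ℝ] TangentSpace (𝓡 2) x) : Prop where
  left (v w : TangentSpace (𝓡 2) x) : B (rotation o g x v) w = -rotation o g x (B v w)
  right (v w : TangentSpace (𝓡 2) x) : B v (rotation o g x w) = -rotation o g x (B v w)

variable (o : SurfaceOrientation M) (g : Metric M) (x : M)

/-- Uniqueness in the decomposition of cubic forms. With `B(e, e) = p e + q Je`, the unknowns are
`η(e)`, `η(Je)`, `p`, `q`, and the vectors `e`, `Je`, `e ± Je` give four independent linear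
equations. -/
theorem eq_zero_of_cubic_add_linear
    (B : TangentSpace (𝓡 2) x →ₗ[ℝ] TangentSpace (𝓡 2) x →ₗ[ℝ] TangentSpace (𝓡 2) x)
    (hB : IsCubicTypeAt o g x B) (η : TangentSpace (𝓡 2) x →ₗ[ℝ] ℝ)
    (h : ∀ v, g.inner x v v * η (rotation o g x v) +
      g.inner x (rotation o g x v) (B v v) = 0) : η = 0 ∧ B = 0 := by
  obtain ⟨e, he⟩ := exists_ne_zero x
  set J := rotation o g x with hJ
  have hJJ : ∀ v, J (J v) = -v := rotation_rotation o g x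
  obtain ⟨p, q, hpq⟩ := exists_coords o g x he (B e e)
  rw [← hJ] at hpq
  have hpos := g.pos x e he
  have e1 : g.inner x e (J e) = 0 := inner_self_rotation o g x e
  have e2 : g.inner x (J e) e = 0 := inner_rotation_self o g x e
  have e3 : g.inner x (J e) (J e) = g.inner x e e := inner_rotation_rotation o g x e e
  have b12 : B e (J e) = -J (B e e) := hB.right e e
  have b21 : B (J e) e = -J (B e e) := hB.left e e
  have b22 : B (J e) (J e) = -B e e := by rw [hB.left, b12, map_neg, neg_neg]; exact hJJ _
  have h1 := h e
  have h2 := h (J e)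
  have h3 := h (e + J e)
  have h4 := h (e - J e)
  simp only [map_add, map_sub, map_neg, LinearMap.add_apply, LinearMap.sub_apply,
    _root_.add_apply, _root_.sub_apply, _root_.neg_apply,
    b12, b21, b22, hpq, hJJ, map_smul, smul_eq_mul, e1, e2, e3]
    at h1 h2 h3 h4
  set G := g.inner x e e
  have c1 : η (J e) + q = 0 := mul_left_cancel₀ hpos.ne' (by linarith)
  have c2 : -η e + p = 0 := mul_left_cancel₀ hpos.ne' (by linarith)
  have c3 : η (J e) - η e - p - q = 0 := mul_left_cancel₀ hpos.ne' (by linarith)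
  have c4 : η (J e) + η e + p - q = 0 := mul_left_cancel₀ hpos.ne' (by linarith)
  have d1 : η e = 0 := by linarith
  have d2 : η (J e) = 0 := by linarith
  have hp : p = 0 := by linarith
  have hq : q = 0 := by linarith
  have hBe : B e e = 0 := by rw [hpq, hp, hq]; simp
  refine ⟨LinearMap.ext fun v => ?_, LinearMap.ext fun v => LinearMap.ext fun w => ?_⟩
  · obtain ⟨a, b, rfl⟩ := exists_coords o g x he v
    simp [← hJ, d1, d2]
  · obtain ⟨a, b, rfl⟩ := exists_coords o g x he v
    obtain ⟨a', b', rfl⟩ := exists_coords o g x he w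
    simp [← hJ, b12, b21, b22, hBe]

/-- The part of cubic type of a field of bilinear maps. -/
def cubicPart (S : EndForm M) : EndForm M := fun x =>
  -- The composite of the two commuting projections `S ↦ ½ (S(v, w) + J S(Jv, w))` and `S ↦ ½ (S(v,
  -- w) + J S(v, Jw))` onto tensors antilinear in one argument.
  (1 / 4 : ℝ) • (S x - (S x).compl₁₂ (rotation o g x) (rotation o g x)
    + ((S x).comp (rotation o g x) + (S x).compl₂ (rotation o g x)).compr₂ (rotation o g x))

theorem cubicPart_apply (S : EndForm M) (v w : TangentSpace (𝓡 2) x) :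
    cubicPart o g S x v w = (1 / 4 : ℝ) • (S x v w - S x (rotation o g x v) (rotation o g x w) +
      rotation o g x (S x (rotation o g x v) w + S x v (rotation o g x w))) := by
  simp [cubicPart]

theorem isCubicTypeAt_cubicPart (S : EndForm M) : IsCubicTypeAt o g x (cubicPart o g S x) where
  left v w := by
    simp only [cubicPart_apply, rotation_rotation, map_smul, map_add, map_sub, map_neg,
      LinearMap.neg_apply]
    module
  right v w := by
    simp only [cubicPart_apply, rotation_rotation, map_smul, map_add, map_sub, map_neg]
    module

/-- `g(u, u)` times the linear form `θ` for which `S` is projectively equivalent to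
`g ⊗ θ^♯ - Sym(θ)` up to a part of cubic type. -/
def weylPartAux (S : EndForm M) (u : TangentSpace (𝓡 2) x) : TangentSpace (𝓡 2) x →ₗ[ℝ] ℝ :=
  -- After division by `g(u, u)` this is `¾ tr_g S - ½ tr S(v, ·)`. Both traces vanish on cubic
  -- type; they are `2η` and `3η` on `Sym(η)`, and `0` and `-2θ` on `g ⊗ θ^♯ - Sym(θ)`. The
  -- coefficients are those that annihilate `Sym(η)` and return `θ`.
  (3 / 4 : ℝ) • (g.inner x (S x u u + S x (rotation o g x u) (rotation o g x u))).toLinearMap -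
  (1 / 2 : ℝ) • ((g.inner x u).toLinearMap ∘ₗ (S x).flip u +
    (g.inner x (rotation o g x u)).toLinearMap ∘ₗ (S x).flip (rotation o g x u))

theorem weylPartAux_apply (S : EndForm M) (u v : TangentSpace (𝓡 2) x) :
    weylPartAux o g x S u v =
      (3 / 4 : ℝ) * (g.inner x (S x u u) v +
        g.inner x (S x (rotation o g x u) (rotation o g x u)) v) -
      (1 / 2 : ℝ) * (g.inner x u (S x v u) +
        g.inner x (rotation o g x u) (S x v (rotation o g x u))) := by
  simp only [weylPartAux, LinearMap.sub_apply, LinearMap.smul_apply, LinearMap.add_apply, map_add,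
    LinearMap.comp_apply, LinearMap.flip_apply, ContinuousLinearMap.coe_coe, smul_eq_mul,
    _root_.add_apply]

/-- The two terms are traces computed in the frame `(u, Ju)`, so they depend on `u` only through the
factor `g(u, u)`. This makes `weylPart` independent of the chosen vector. -/
theorem inner_smul_weylPartAux (S : EndForm M) (e u v : TangentSpace (𝓡 2) x) (he : e ≠ 0) :
    g.inner x e e * weylPartAux o g x S u v = g.inner x u u * weylPartAux o g x S e v := by
  obtain ⟨a, b, rfl⟩ := exists_coords o g x he u
  have e1 := inner_self_rotation o g x e
  have e2 := inner_rotation_self o g x e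
  have e3 := inner_rotation_rotation o g x e e
  simp only [weylPartAux_apply, map_add, map_smul, map_neg, LinearMap.add_apply,
    LinearMap.smul_apply, LinearMap.neg_apply, _root_.add_apply,
    _root_.smul_apply, _root_.neg_apply, rotation_rotation, smul_eq_mul,
    e1, e2, e3, smul_neg]
  ring

/-- The linear form `θ` at `x` for which `S` is projectively equivalent to `g ⊗ θ^♯ - Sym(θ)` up to
a part of cubic type. -/
def weylPart (S : EndForm M) : TangentSpace (𝓡 2) x →ₗ[ℝ] ℝ :=
  (g.inner x (exists_ne_zero x).choose (exists_ne_zero x).choose)⁻¹ •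
    weylPartAux o g x S (exists_ne_zero x).choose

theorem weylPart_apply (S : EndForm M) {u : TangentSpace (𝓡 2) x} (hu : u ≠ 0)
    (v : TangentSpace (𝓡 2) x) :
    weylPart o g x S v = weylPartAux o g x S u v / g.inner x u u := by
  have he := (exists_ne_zero x).choose_spec
  have h := inner_smul_weylPartAux o g x S _ u v he
  have h1 := (g.pos x u hu).ne'
  have h2 := (g.pos x _ he).ne'
  simp only [weylPart, LinearMap.smul_apply, smul_eq_mul]
  field_simp
  linarith

/-- Existence in the decomposition of cubic forms. -/
theorem inner_weylPart_add_cubicPart (S : EndForm M) (hS : ∀ v w, S x v w = S x w v)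
    (v : TangentSpace (𝓡 2) x) :
    g.inner x v v * weylPart o g x S (rotation o g x v) +
      g.inner x (rotation o g x v) (cubicPart o g S x v v) =
      g.inner x (rotation o g x v) (S x v v) := by
  by_cases hv : v = 0
  · simp [hv]
  have hpos := (g.pos x v hv).ne'
  -- Computing the traces in the frame `(v, Jv)` leaves only the values of `S` on that frame. The
  -- coefficients of `g(Jv, S(v, v))` add up to `1`, all others cancel by symmetry of `S`.
  rw [weylPart_apply o g x S hv, mul_div_cancel₀ _ hpos]
  have i1 : ∀ w, g.inner x (rotation o g x v) (rotation o g x w) = g.inner x v w :=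
    inner_rotation_rotation o g x v
  simp only [weylPartAux_apply, cubicPart_apply, map_smul, map_add, map_sub, smul_eq_mul, i1]
  rw [hS (rotation o g x v) v, g.symm x (S x v v),
    g.symm x (S x (rotation o g x v) (rotation o g x v))]
  ring

end CubicType

/-! ### Smoothness of fields, of `J` and of covariant derivatives -/

section SmoothCalculus

theorem SmoothField.differentiableAt {X : (x : M) → TangentSpace (𝓡 2) x} (hX : SmoothField X)
    (x : M) : DifferentiableFieldAt X x :=
  (hX x).mdifferentiableAt (by simp)

theorem SmoothFieldAt.congr {X Y : (x : M) → TangentSpace (𝓡 2) x} {x₀ : M}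
    (hX : SmoothFieldAt X x₀) (h : ∀ᶠ x in 𝓝 x₀, Y x = X x) : SmoothFieldAt Y x₀ :=
  ContMDiffAt.congr_of_eventuallyEq hX (h.mono fun x hx => by simp [hx])

theorem SmoothFieldAt.add {X Y : (x : M) → TangentSpace (𝓡 2) x} {x₀ : M}
    (hX : SmoothFieldAt X x₀) (hY : SmoothFieldAt Y x₀) :
    SmoothFieldAt (fun x => X x + Y x) x₀ :=
  ContMDiffAt.add_section hX hY

theorem SmoothFieldAt.sub {X Y : (x : M) → TangentSpace (𝓡 2) x} {x₀ : M}
    (hX : SmoothFieldAt X x₀) (hY : SmoothFieldAt Y x₀) :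
    SmoothFieldAt (fun x => X x - Y x) x₀ :=
  ContMDiffAt.sub_section hX hY

theorem SmoothFieldAt.smul {f : M → ℝ} {X : (x : M) → TangentSpace (𝓡 2) x} {x₀ : M}
    (hf : ContMDiffAt (𝓡 2) 𝓘(ℝ, ℝ) ∞ f x₀) (hX : SmoothFieldAt X x₀) :
    SmoothFieldAt (fun x => f x • X x) x₀ :=
  ContMDiffAt.smul_section hf hX

theorem SmoothField.add {X Y : (x : M) → TangentSpace (𝓡 2) x}
    (hX : SmoothField X) (hY : SmoothField Y) : SmoothField (fun x => X x + Y x) :=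
  ContMDiff.add_section hX hY

theorem SmoothField.sub {X Y : (x : M) → TangentSpace (𝓡 2) x}
    (hX : SmoothField X) (hY : SmoothField Y) : SmoothField (fun x => X x - Y x) :=
  ContMDiff.sub_section hX hY

theorem SmoothField.neg {X : (x : M) → TangentSpace (𝓡 2) x}
    (hX : SmoothField X) : SmoothField (fun x => -X x) :=
  ContMDiff.neg_section hX

theorem SmoothField.smul {f : M → ℝ} {X : (x : M) → TangentSpace (𝓡 2) x}
    (hf : SmoothFun f) (hX : SmoothField X) : SmoothField (fun x => f x • X x) :=
  ContMDiff.smul_section hf hX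

theorem SmoothField.const_smul (a : ℝ) {X : (x : M) → TangentSpace (𝓡 2) x}
    (hX : SmoothField X) : SmoothField (fun x => a • X x) :=
  ContMDiff.const_smul_section hX

theorem SmoothFieldAt.inner (g : Metric M) {X Y : (x : M) → TangentSpace (𝓡 2) x} {x₀ : M}
    (hX : SmoothFieldAt X x₀) (hY : SmoothFieldAt Y x₀) :
    ContMDiffAt (𝓡 2) 𝓘(ℝ, ℝ) ∞ (fun x => g.inner x (X x) (Y x)) x₀ := by
  let _ : RiemannianBundle (fun x : M => TangentSpace (𝓡 2) x) := ⟨g.toRiemannianMetric⟩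
  exact ContMDiffAt.inner_bundle hX hY

theorem SmoothField.inner (g : Metric M) {X Y : (x : M) → TangentSpace (𝓡 2) x}
    (hX : SmoothField X) (hY : SmoothField Y) : SmoothFun (fun x => g.inner x (X x) (Y x)) :=
  fun x => SmoothFieldAt.inner g (hX x) (hY x)

/-- A tangent vector extends to a global smooth field, which near the base point has constant
components in the preferred trivialization. -/
theorem exists_smoothField_eq_extend [T2Space M] (x₀ : M) (v : TangentSpace (𝓡 2) x₀) :
    ∃ U : (x : M) → TangentSpace (𝓡 2) x, SmoothField U ∧
      ∀ᶠ x in 𝓝 x₀, U x = FiberBundle.extend Plane v x := by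
  obtain ⟨s, hs, hv⟩ := FiberBundle.exists_contMDiffOn_extend (k := ∞) (𝓡 2) Plane v
  obtain ⟨t, hts, ht, hxt⟩ := mem_nhds_iff.1 hs
  obtain ⟨f, -, hf⟩ := ((SmoothBumpFunction.nhds_basis_tsupport (I := 𝓡 2) x₀).mem_iff).1
    (ht.mem_nhds hxt)
  refine ⟨fun x => f x • FiberBundle.extend Plane v x, ?_, ?_⟩
  · exact ContMDiffOn.smul_section_of_tsupport (f.contMDiff.contMDiffOn) ht hf (hv.mono hts)
  · filter_upwards [f.eventuallyEq_one] with x hx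
    rw [hx]; simp

theorem exists_smoothField_eq [T2Space M] (x₀ : M) (v : TangentSpace (𝓡 2) x₀) :
    ∃ U : (x : M) → TangentSpace (𝓡 2) x, SmoothField U ∧ U x₀ = v := by
  obtain ⟨U, hU, h⟩ := exists_smoothField_eq_extend x₀ v
  exact ⟨U, hU, by rw [h.self_of_nhds]; simp⟩

theorem SmoothField.inner_self_ne_zero (g : Metric M) {U : (x : M) → TangentSpace (𝓡 2) x}
    (hU : SmoothField U) {x₀ : M} (h : U x₀ ≠ 0) :
    ∀ᶠ x in 𝓝 x₀, g.inner x (U x) (U x) ≠ 0 :=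
  (hU.inner g hU).continuous.continuousAt.eventually_ne (g.pos x₀ _ h).ne'

/-- `g(Jb₀, b₁)` is the area form of the pair, which is positive on positively oriented bases. -/
theorem areaForm_pos (o : SurfaceOrientation M) (g : Metric M) (x : M)
    (b : Basis (Fin 2) ℝ (TangentSpace (𝓡 2) x)) (hb : b.orientation = o.orient x) :
    0 < g.inner x (rotation o g x (b 0)) (b 1) := by
  let _ : RiemannianBundle (fun x : M => TangentSpace (𝓡 2) x) := ⟨g.toRiemannianMetric⟩
  have h2 : finrank ℝ (TangentSpace (𝓡 2) x) = 2 := Fact.out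
  let e := (o.orient x).finOrthonormalBasis (by norm_num) h2
  have he : e.toBasis.orientation = o.orient x :=
    (o.orient x).finOrthonormalBasis_orientation (by norm_num) h2
  have hdet : 0 < e.toBasis.det b :=
    (Basis.orientation_eq_iff_det_pos _ _).1 (he.trans hb.symm)
  rw [← (o.orient x).volumeForm_robust e he] at hdet
  have : (⇑b : Fin 2 → TangentSpace (𝓡 2) x) = ![b 0, b 1] := by
    ext i; fin_cases i <;> rfl
  rw [this, ← (o.orient x).areaForm_to_volumeForm,
    ← (o.orient x).inner_rightAngleRotation_left] at hdet
  exact hdet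

/-- Gram–Schmidt: the part of `b₁` orthogonal to `b₀` is a positive multiple of `Jb₀`, and the
factor is the positive root of the Gram determinant. The formula shows that `J` depends smoothly on
the base point. -/
theorem rotation_eq_of_basis (o : SurfaceOrientation M) (g : Metric M) (x : M)
    (b : Basis (Fin 2) ℝ (TangentSpace (𝓡 2) x)) (hb : b.orientation = o.orient x) :
    rotation o g x (b 0) =
      (Real.sqrt (g.inner x (b 0) (b 0) * g.inner x (b 1) (b 1) - g.inner x (b 0) (b 1) ^ 2))⁻¹ •
        (g.inner x (b 0) (b 0) • b 1 - g.inner x (b 0) (b 1) • b 0) := by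
  have hpos := areaForm_pos o g x b hb
  have h := inner_self_smul_eq o g x (b 0) (b 1)
  have h2 := congrArg (fun z => g.inner x z (b 1)) h
  simp only [map_add, map_smul, _root_.add_apply, _root_.smul_apply, smul_eq_mul] at h2
  have h3 : g.inner x (b 0) (b 0) * g.inner x (b 1) (b 1) - g.inner x (b 0) (b 1) ^ 2 =
      g.inner x (rotation o g x (b 0)) (b 1) ^ 2 := by linarith
  rw [h3, Real.sqrt_sq hpos.le, h, add_sub_cancel_left, smul_smul, inv_mul_cancel₀ hpos.ne',
    one_smul]

theorem rotation_eq_of_frame (o : SurfaceOrientation M) (g : Metric M) (x : M)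
    {u : TangentSpace (𝓡 2) x} (hu : u ≠ 0) (v : TangentSpace (𝓡 2) x) :
    rotation o g x v = (g.inner x u u)⁻¹ •
      (g.inner x u v • rotation o g x u - g.inner x (rotation o g x u) v • u) := by
  have h := congrArg (rotation o g x) (inner_self_smul_eq o g x u v)
  simp only [map_add, map_smul, rotation_rotation] at h
  rw [smul_neg, ← sub_eq_add_neg] at h
  rw [← h, smul_smul, inv_mul_cancel₀ (g.pos x u hu).ne', one_smul]

/-- For the first vector `U` of an oriented local frame, `JU` is smooth by `rotation_eq_of_basis`;
`rotation_eq_of_frame` then expresses `JX` through `U`, `JU` and inner products. -/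
theorem SmoothField.rotation {X : (x : M) → TangentSpace (𝓡 2) x}
    (hX : SmoothField X) (o : SurfaceOrientation M) (g : Metric M) :
    SmoothField (fun x => rotation o g x (X x)) := by
  intro x₀
  obtain ⟨U, V, hU, hV, hb⟩ := o.exists_frame x₀
  have hUU := hU.inner g hU
  have hUV := hU.inner g hV
  have hVV := hV.inner g hV
  have hne : U x₀ ≠ 0 := by
    obtain ⟨b, h0, -⟩ := hb.self_of_nhds
    rw [← h0]; exact b.ne_zero 0
  have hD : 0 < g.inner x₀ (U x₀) (U x₀) * g.inner x₀ (V x₀) (V x₀) -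
      g.inner x₀ (U x₀) (V x₀) ^ 2 := by
    obtain ⟨b, h0, h1, hor⟩ := hb.self_of_nhds
    have hpos := areaForm_pos o g x₀ b hor
    have h2 := congrArg (fun z => g.inner x₀ z (b 1)) (inner_self_smul_eq o g x₀ (b 0) (b 1))
    simp only [map_add, map_smul, _root_.add_apply, _root_.smul_apply, smul_eq_mul] at h2
    rw [← h0, ← h1]
    nlinarith
  have hJU : SmoothFieldAt (fun x => WeylProjective.rotation o g x (U x)) x₀ := by
    have hsq : ContMDiffAt (𝓡 2) 𝓘(ℝ, ℝ) ∞ (fun x => (Real.sqrt (g.inner x (U x) (U x) *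
        g.inner x (V x) (V x) - g.inner x (U x) (V x) ^ 2))⁻¹) x₀ := by
      have h1 := (hUU.mul hVV).sub (hUV.pow 2)
      have h2 : ContDiffAt ℝ ∞ (fun r : ℝ => (Real.sqrt r)⁻¹)
          (g.inner x₀ (U x₀) (U x₀) * g.inner x₀ (V x₀) (V x₀) -
            g.inner x₀ (U x₀) (V x₀) ^ 2) :=
        ContDiffAt.inv (Real.contDiffAt_sqrt hD.ne') (Real.sqrt_ne_zero'.2 hD)
      exact ContMDiffAt.comp (g := fun r : ℝ => (Real.sqrt r)⁻¹) x₀ h2.contMDiffAt h1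
    refine ((SmoothFieldAt.smul hsq ((SmoothFieldAt.smul hUU hV).sub
      (SmoothFieldAt.smul hUV hU)))).congr ?_
    filter_upwards [hb] with x ⟨b, h0, h1, hor⟩
    rw [← h0, ← h1]
    exact rotation_eq_of_basis o g x b hor
  have hUU' : ContMDiffAt (𝓡 2) 𝓘(ℝ, ℝ) ∞ (fun x => (g.inner x (U x) (U x))⁻¹) x₀ :=
    (contDiffAt_inv ℝ (g.pos x₀ _ hne).ne').contMDiffAt.comp x₀ hUU
  refine (SmoothFieldAt.smul hUU' ((SmoothFieldAt.smul (hU.inner g (hX x₀)) hJU).sub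
    (SmoothFieldAt.smul (hJU.inner g (hX x₀)) hU))).congr ?_
  filter_upwards [hb] with x ⟨b, h0, _⟩
  refine rotation_eq_of_frame o g x ?_ _
  rw [← h0]; exact b.ne_zero 0

/-- A nowhere vanishing global field need not exist, so each point uses its own `U`, nonzero there,
and divides by `g(U, U)` nearby. -/
theorem smoothFun_of_mul_inner [T2Space M] (g : Metric M) {f : M → ℝ}
    (h : ∀ U : (x : M) → TangentSpace (𝓡 2) x, SmoothField U →
      SmoothFun fun x => g.inner x (U x) (U x) * f x) : SmoothFun f := by
  intro x₀
  obtain ⟨u, hu⟩ := exists_ne_zero x₀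
  obtain ⟨U, hU, hUu⟩ := exists_smoothField_eq x₀ u
  have hne : U x₀ ≠ 0 := by rwa [hUu]
  have hinv : ContMDiffAt (𝓡 2) 𝓘(ℝ, ℝ) ∞ (fun x => (g.inner x (U x) (U x))⁻¹) x₀ :=
    (contDiffAt_inv ℝ (g.pos x₀ _ hne).ne').contMDiffAt.comp x₀ (hU.inner g hU x₀)
  refine (hinv.mul (h U hU x₀)).congr_of_eventuallyEq ?_
  filter_upwards [hU.inner_self_ne_zero g hne] with x hx
  simp only [Pi.mul_apply]
  rw [← mul_assoc, inv_mul_cancel₀ hx, one_mul]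

/-- Near each point `Z` is recovered from its inner products with `U` and `JU`, where `U` is nonzero
at that point. -/
theorem smoothField_of_inner [T2Space M] (o : SurfaceOrientation M) (g : Metric M)
    {Z : (x : M) → TangentSpace (𝓡 2) x}
    (h : ∀ U : (x : M) → TangentSpace (𝓡 2) x, SmoothField U →
      SmoothFun fun x => g.inner x (Z x) (U x)) : SmoothField Z := by
  intro x₀
  obtain ⟨u, hu⟩ := exists_ne_zero x₀
  obtain ⟨U, hU, hUu⟩ := exists_smoothField_eq x₀ u
  have hne : U x₀ ≠ 0 := by rwa [hUu]
  have hinv : ContMDiffAt (𝓡 2) 𝓘(ℝ, ℝ) ∞ (fun x => (g.inner x (U x) (U x))⁻¹) x₀ :=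
    (contDiffAt_inv ℝ (g.pos x₀ _ hne).ne').contMDiffAt.comp x₀ (hU.inner g hU x₀)
  have hJU := hU.rotation o g
  refine (SmoothFieldAt.smul hinv ((SmoothFieldAt.smul (h U hU x₀) (hU x₀)).add
    (SmoothFieldAt.smul (h _ hJU x₀) (hJU x₀)))).congr ?_
  filter_upwards [hU.inner_self_ne_zero g hne] with x hx
  have h := inner_self_smul_eq o g x (U x) (Z x)
  rw [g.symm x (U x) (Z x), g.symm x (rotation o g x (U x)) (Z x)] at h
  rw [← h, smul_smul, inv_mul_cancel₀ hx, one_smul]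

theorem SmoothField.sharp [T2Space M] (o : SurfaceOrientation M) (g : Metric M)
    {η : (x : M) → TangentSpace (𝓡 2) x →ₗ[ℝ] ℝ}
    (h : ∀ U : (x : M) → TangentSpace (𝓡 2) x, SmoothField U → SmoothFun fun x => η x (U x)) :
    SmoothField (fun x => sharp g x (η x)) :=
  smoothField_of_inner o g fun U hU => by simpa only [inner_sharp] using h U hU

/-- A section of the endomorphism bundle is smooth as soon as it maps smooth fields to smooth
fields. -/
theorem contMDiff_hom_of_apply [T2Space M]
    {A : (x : M) → TangentSpace (𝓡 2) x →L[ℝ] TangentSpace (𝓡 2) x}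
    (h : ∀ U : (x : M) → TangentSpace (𝓡 2) x, SmoothField U → SmoothField fun x => A x (U x)) :
    ContMDiff (𝓡 2) ((𝓡 2).prod 𝓘(ℝ, Plane →L[ℝ] Plane)) ∞
      (fun x => TotalSpace.mk' (Plane →L[ℝ] Plane)
        (E := fun x : M => TangentSpace (𝓡 2) x →L[ℝ] TangentSpace (𝓡 2) x) x (A x)) := by
  intro x₀
  rw [contMDiffAt_hom_bundle]
  refine ⟨contMDiffAt_id, ?_⟩
  let e := trivializationAt Plane (fun x : M => TangentSpace (𝓡 2) x) x₀
  let b := EuclideanSpace.basisFun (Fin 2) ℝ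
  have hx₀ : x₀ ∈ e.baseSet := FiberBundle.mem_baseSet_trivializationAt' x₀
  choose U hU hUe using fun i => exists_smoothField_eq_extend x₀ (e.symm x₀ (b i))
  have hc : ∀ i, ContMDiffAt (𝓡 2) 𝓘(ℝ, Plane) ∞
      (fun x => (e ⟨x, A x (U i x)⟩).2) x₀ := fun i =>
    (contMDiffAt_section x₀).1 (h _ (hU i) x₀)
  -- In coordinates an endomorphism is the sum over the basis of the coordinate functional times the
  -- image of the basis vector. Those images are smooth by hypothesis, after extension of the basis
  -- vectors to global fields.
  have hs : ContMDiffAt (𝓡 2) 𝓘(ℝ, Plane →L[ℝ] Plane) ∞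
      (fun x => ∑ i, ContinuousLinearMap.smulRightL ℝ Plane Plane (EuclideanSpace.proj i)
        ((e ⟨x, A x (U i x)⟩).2)) x₀ := by
    refine contMDiffAt_finsetSum fun i _ => ?_
    exact (ContinuousLinearMap.contMDiff _).contMDiffAt.comp x₀ (hc i)
  refine hs.congr_of_eventuallyEq ?_
  filter_upwards [Filter.eventually_all.2 hUe, e.open_baseSet.mem_nhds hx₀] with x hx hxe
  refine ContinuousLinearMap.ext fun w => ?_
  rw [ContinuousLinearMap.inCoordinates_eq hxe hxe]
  have hUx : ∀ i, U i x = e.symm x (b i) := fun i => by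
    rw [hx i]
    simp only [FiberBundle.extend]
    congr 1
    exact congrArg Prod.snd (e.apply_mk_symm hx₀ (b i))
  conv_lhs => rw [← b.sum_repr w]
  simp only [map_sum, map_smul, _root_.sum_apply]
  refine Finset.sum_congr rfl fun i _ => ?_
  rw [hUx]
  simp [b]
  rfl

theorem IsSmooth.apply {D : Connection M} (hD : IsSmooth D)
    {X Y : (x : M) → TangentSpace (𝓡 2) x} (hX : SmoothField X) (hY : SmoothField Y) :
    SmoothField (fun x => D Y x (X x)) := by
  have h := hD.contMDiff.contMDiff (σ := Y) (ContMDiff.contMDiffOn hY)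
  exact ContMDiff.clm_bundle_apply (contMDiffOn_univ.1 h) hX

theorem isSmooth_of_apply [T2Space M] {D : Connection M}
    (h : ∀ X Y : (x : M) → TangentSpace (𝓡 2) x, SmoothField X → SmoothField Y →
      SmoothField (fun x => D Y x (X x))) : IsSmooth D :=
  ⟨⟨fun {σ} hσ => (contMDiff_hom_of_apply fun U hU => h U σ hU
    (contMDiffOn_univ.1 hσ)).contMDiffOn⟩⟩

/-- By the Leibniz rule `D_X(fU) - f D_X U = X(f) U`; pairing with `U` gives `g(U, U) X(f)`, so
smoothness of `df` is inherited from that of `D`. -/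
theorem SmoothFun.mvfderiv_apply [T2Space M] {D : Connection M} (hD : IsSmooth D) (g : Metric M)
    {f : M → ℝ} (hf : SmoothFun f) {X : (x : M) → TangentSpace (𝓡 2) x} (hX : SmoothField X) :
    SmoothFun (fun x => mvfderiv (𝓡 2) f x (X x)) := by
  refine smoothFun_of_mul_inner g fun U hU => ?_
  have h1 := hD.apply hX (hU.smul hf)
  have h2 := (hD.apply hX hU).smul hf
  have h3 := (h1.sub h2).inner g hU
  refine ContMDiff.congr h3 fun x => ?_
  have := D.isCovariantDerivativeOnUniv.leibniz (σ := U) (g := f) (x := x)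
    (hU.differentiableAt x) ((hf x).mdifferentiableAt (by simp))
  have e : (fun x => f x • U x) = f • U := rfl
  rw [e, this]
  simp
  ring

end SmoothCalculus

/-! ### The Levi-Civita connection, by the Koszul formula -/

section LeviCivita

@[simp]
theorem addEndForm_apply (D : Connection M) (B : EndForm M)
    (Y : (x : M) → TangentSpace (𝓡 2) x) (x : M) (v : TangentSpace (𝓡 2) x) :
    addEndForm D B Y x v = D Y x v + B x v (Y x) := rfl

theorem isLeviCivita_iff (g : Metric M) (D : Connection M) :
    IsLeviCivita g D ↔
      (∀ (X Y : (x : M) → TangentSpace (𝓡 2) x) (x : M), DifferentiableFieldAt X x →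
        DifferentiableFieldAt Y x →
        D Y x (X x) - D X x (Y x) = VectorField.mlieBracket (𝓡 2) X Y x) ∧
      ∀ (X Y Z : (x : M) → TangentSpace (𝓡 2) x) (x : M), DifferentiableFieldAt X x →
        DifferentiableFieldAt Y x → DifferentiableFieldAt Z x →
        mvfderiv (𝓡 2) (fun y => g.inner y (Y y) (Z y)) x (X x) =
          g.inner x (D Y x (X x)) (Z x) + g.inner x (Y x) (D Z x (X x)) := by
  let _ : RiemannianBundle (fun x : M => TangentSpace (𝓡 2) x) := ⟨g.toRiemannianMetric⟩
  refine and_congr ?_ ?_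
  · rw [CovariantDerivative.torsion_eq_zero_iff]
    exact ⟨fun h X Y x hX hY => h hX hY, fun h X Y x hX hY => h X Y x hX hY⟩
  · rw [CovariantDerivative.isMetricCompatible_iff]
    exact ⟨fun h X Y Z x hX hY hZ => h hX hY hZ, fun h x X Y Z hX hY hZ => h X Y Z x hX hY hZ⟩

theorem torsion_eq_zero_apply {D : Connection M} (hD : D.torsion = 0)
    {X Y : (x : M) → TangentSpace (𝓡 2) x} {x : M} (hX : DifferentiableFieldAt X x)
    (hY : DifferentiableFieldAt Y x) :
    D Y x (X x) - D X x (Y x) = VectorField.mlieBracket (𝓡 2) X Y x :=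
  (CovariantDerivative.torsion_eq_zero_iff D).1 hD hX hY

/-- The covariant derivative of the metric `g`: the trilinear form `(v, w, z) ↦ (D_z g)(v, w)`. -/
def metricDerivative (D : Connection M) (g : Metric M) (x : M) :
    TangentSpace (𝓡 2) x →L[ℝ] TangentSpace (𝓡 2) x →L[ℝ] TangentSpace (𝓡 2) x →L[ℝ] ℝ :=
  letI : RiemannianBundle (fun x : M => TangentSpace (𝓡 2) x) := ⟨g.toRiemannianMetric⟩
  D.derivMetricTensor x

theorem metricDerivative_apply (D : Connection M) (g : Metric M) {x : M}
    {Y Z : (x : M) → TangentSpace (𝓡 2) x} (hY : DifferentiableFieldAt Y x)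
    (hZ : DifferentiableFieldAt Z x) (v : TangentSpace (𝓡 2) x) :
    metricDerivative D g x (Y x) (Z x) v =
      mvfderiv (𝓡 2) (fun y => g.inner y (Y y) (Z y)) x v -
        g.inner x (D Y x v) (Z x) - g.inner x (Y x) (D Z x v) := by
  let _ : RiemannianBundle (fun x : M => TangentSpace (𝓡 2) x) := ⟨g.toRiemannianMetric⟩
  have h := D.derivMetricTensor_apply (X := FiberBundle.extend Plane v) x hY hZ
  simp only [FiberBundle.extend_apply_self] at h
  exact h

theorem differentiableAt_extend {x : M} (v : TangentSpace (𝓡 2) x) :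
    DifferentiableFieldAt (FiberBundle.extend Plane v) x :=
  FiberBundle.mdifferentiableAt_extend (𝓡 2) Plane v

theorem metricDerivative_symm (D : Connection M) (g : Metric M) (x : M)
    (v w z : TangentSpace (𝓡 2) x) :
    metricDerivative D g x v w z = metricDerivative D g x w v z := by
  have h1 := metricDerivative_apply D g (differentiableAt_extend v) (differentiableAt_extend w) z
  have h2 := metricDerivative_apply D g (differentiableAt_extend w) (differentiableAt_extend v) z
  simp only [FiberBundle.extend_apply_self] at h1 h2
  rw [h1, h2]
  simp only [g.symm _ (FiberBundle.extend Plane v _) (FiberBundle.extend Plane w _)]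
  rw [g.symm x v, g.symm x w]
  ring

section

variable (D : Connection M) (g : Metric M) (x : M) (a b c d : TangentSpace (𝓡 2) x) (r : ℝ)

theorem metricDerivative_add₁ : metricDerivative D g x (a + b) c d =
    metricDerivative D g x a c d + metricDerivative D g x b c d :=
  congrArg (fun L => L c d) (ContinuousLinearMap.map_add (metricDerivative D g x) a b)

theorem metricDerivative_add₂ : metricDerivative D g x a (b + c) d =
    metricDerivative D g x a b d + metricDerivative D g x a c d :=
  congrArg (fun L => L d) (ContinuousLinearMap.map_add (metricDerivative D g x a) b c)

theorem metricDerivative_add₃ : metricDerivative D g x a b (c + d) =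
    metricDerivative D g x a b c + metricDerivative D g x a b d :=
  ContinuousLinearMap.map_add (metricDerivative D g x a b) c d

theorem metricDerivative_smul₁ : metricDerivative D g x (r • a) b c =
    r * metricDerivative D g x a b c :=
  congrArg (fun L => L b c) (ContinuousLinearMap.map_smul (metricDerivative D g x) r a)

theorem metricDerivative_smul₂ : metricDerivative D g x a (r • b) c =
    r * metricDerivative D g x a b c :=
  congrArg (fun L => L c) (ContinuousLinearMap.map_smul (metricDerivative D g x a) r b)

theorem metricDerivative_smul₃ : metricDerivative D g x a b (r • c) =
    r * metricDerivative D g x a b c :=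
  ContinuousLinearMap.map_smul (metricDerivative D g x a b) r c

end

theorem metric_add_left (g : Metric M) (x : M) (a b c : TangentSpace (𝓡 2) x) :
    g.inner x (a + b) c = g.inner x a c + g.inner x b c := by
  simp

theorem metric_smul_left (g : Metric M) (x : M) (r : ℝ) (a b : TangentSpace (𝓡 2) x) :
    g.inner x (r • a) b = r * g.inner x a b := by
  simp

/-- The linear form `z ↦ ½ ((D_v g)(w, z) + (D_w g)(v, z) - (D_z g)(v, w))`. -/
def koszulForm (D : Connection M) (g : Metric M) (x : M) (v w : TangentSpace (𝓡 2) x) :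
    TangentSpace (𝓡 2) x →ₗ[ℝ] ℝ where
  toFun z := (1 / 2 : ℝ) * (metricDerivative D g x w z v + metricDerivative D g x v z w -
    metricDerivative D g x v w z)
  map_add' a b := by simp only [metricDerivative_add₂, metricDerivative_add₃]; ring
  map_smul' r a := by
    simp only [metricDerivative_smul₂, metricDerivative_smul₃, RingHom.id_apply, smul_eq_mul]; ring

theorem koszulForm_apply (D : Connection M) (g : Metric M) (x : M)
    (v w z : TangentSpace (𝓡 2) x) :
    koszulForm D g x v w z = (1 / 2 : ℝ) * (metricDerivative D g x w z v +
      metricDerivative D g x v z w - metricDerivative D g x v w z) := rfl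

/-- The difference between the Levi-Civita connection of `g` and the torsion-free
connection `D`. -/
def leviCivitaForm (D : Connection M) (g : Metric M) : EndForm M := fun x =>
  LinearMap.mk₂ ℝ (fun v w => sharp g x (koszulForm D g x v w))
    (fun a b c => Eq.symm <| eq_sharp_iff.2 fun z => by
      simp only [metric_add_left, inner_sharp, koszulForm_apply, metricDerivative_add₁,
        metricDerivative_add₃]
      ring)
    (fun r a b => Eq.symm <| eq_sharp_iff.2 fun z => by
      simp only [metric_smul_left, inner_sharp, koszulForm_apply, metricDerivative_smul₁,
        metricDerivative_smul₃]
      ring)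
    (fun a b c => Eq.symm <| eq_sharp_iff.2 fun z => by
      simp only [metric_add_left, inner_sharp, koszulForm_apply, metricDerivative_add₁,
        metricDerivative_add₂, metricDerivative_add₃]
      ring)
    (fun r a b => Eq.symm <| eq_sharp_iff.2 fun z => by
      simp only [metric_smul_left, inner_sharp, koszulForm_apply, metricDerivative_smul₁,
        metricDerivative_smul₂, metricDerivative_smul₃]
      ring)

/-- The Koszul formula relative to `D`. It is the only tensor symmetric in `(v, w)` whose
symmetrisation `g(S(v, w), z) + g(w, S(v, z))` equals `(D_v g)(w, z)`. -/
theorem inner_leviCivitaForm (D : Connection M) (g : Metric M) (x : M)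
    (v w z : TangentSpace (𝓡 2) x) :
    g.inner x (leviCivitaForm D g x v w) z = (1 / 2 : ℝ) * (metricDerivative D g x w z v +
      metricDerivative D g x v z w - metricDerivative D g x v w z) := by
  rw [← koszulForm_apply]
  exact inner_sharp g x _ z

theorem leviCivitaForm_symm (D : Connection M) (g : Metric M) (x : M)
    (v w : TangentSpace (𝓡 2) x) : leviCivitaForm D g x v w = leviCivitaForm D g x w v :=
  eq_of_inner_eq (g := g) fun z => by
    rw [inner_leviCivitaForm, inner_leviCivitaForm, metricDerivative_symm D g x v w z]
    ring

/-- The Levi-Civita connection of `g`, obtained by correcting a torsion-free connection. -/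
def leviCivita (D : Connection M) (g : Metric M) : Connection M :=
  addEndForm D (leviCivitaForm D g)

/-- Symmetry of the correction preserves vanishing torsion; its symmetrisation in the last two slots
cancels `Dg`. -/
theorem isLeviCivita_leviCivita {D : Connection M} (hD : D.torsion = 0) (g : Metric M) :
    IsLeviCivita g (leviCivita D g) := by
  refine (isLeviCivita_iff g _).2 ⟨fun X Y x hX hY => ?_, fun X Y Z x _ hY hZ => ?_⟩
  · rw [← torsion_eq_zero_apply hD hX hY, leviCivita, addEndForm_apply, addEndForm_apply,
      leviCivitaForm_symm D g x (X x)]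
    abel
  · have h := metricDerivative_apply D g hY hZ (X x)
    rw [leviCivita, addEndForm_apply, addEndForm_apply, map_add, map_add, _root_.add_apply,
      g.symm x (Y x) (leviCivitaForm D g x (X x) (Z x)), inner_leviCivitaForm,
      inner_leviCivitaForm, metricDerivative_symm D g x (Z x) (Y x),
      metricDerivative_symm D g x (X x) (Y x), metricDerivative_symm D g x (X x) (Z x)]
    linarith

theorem SameConnection.symm {D D' : Connection M} (h : SameConnection D D') :
    SameConnection D' D := fun Y x hY => (h Y x hY).symm

theorem SameConnection.trans {D D' D'' : Connection M} (h : SameConnection D D')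
    (h' : SameConnection D' D'') : SameConnection D D'' :=
  fun Y x hY => (h Y x hY).trans (h' Y x hY)

theorem SameConnection.addEndForm {D D' : Connection M} (h : SameConnection D D')
    (B : EndForm M) : SameConnection (addEndForm D B) (addEndForm D' B) :=
  fun Y x hY => by
    ext v : 1
    rw [addEndForm_apply, addEndForm_apply, h Y x hY]

theorem difference_apply (D D' : Connection M) {Y : (x : M) → TangentSpace (𝓡 2) x} {x : M}
    (hY : DifferentiableFieldAt Y x) : D.difference D' x (Y x) = D Y x - D' Y x :=
  IsCovariantDerivativeOn.difference_apply _ _ (Set.mem_univ x) hY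

/-- The difference tensor is symmetric because both torsions vanish, and skew for `g` because both
connections are metric. A trilinear form symmetric in one pair of slots and skew in an overlapping
pair is zero. -/
theorem IsLeviCivita.unique {g : Metric M} {L L' : Connection M} (hL : IsLeviCivita g L)
    (hL' : IsLeviCivita g L') : SameConnection L L' := by
  rw [isLeviCivita_iff] at hL hL'
  let E := fun x => L.difference L' x
  have hsymm : ∀ x v w, E x v w = E x w v := fun x v w => by
    have hv := differentiableAt_extend v
    have hw := differentiableAt_extend w
    have h1 := hL.1 _ _ x hv hw
    have h2 := hL'.1 _ _ x hv hw
    have h3 := difference_apply L L' hv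
    have h4 := difference_apply L L' hw
    simp only [FiberBundle.extend_apply_self] at h1 h2 h3 h4
    simp only [E, h3, h4, _root_.sub_apply]
    rw [← h2, sub_eq_sub_iff_sub_eq_sub] at h1
    exact h1.symm
  have hskew : ∀ x v w z, g.inner x (E x v z) w + g.inner x v (E x w z) = 0 := fun x v w z => by
    have hv := differentiableAt_extend v
    have hw := differentiableAt_extend w
    have hz := differentiableAt_extend z
    have h1 := hL.2 _ _ _ x hz hv hw
    have h2 := hL'.2 _ _ _ x hz hv hw
    have h3 := difference_apply L L' hv
    have h4 := difference_apply L L' hw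
    simp only [FiberBundle.extend_apply_self] at h1 h2 h3 h4
    simp only [E, h3, h4, _root_.sub_apply, map_sub]
    linarith
  have hE : ∀ x v w, E x v w = 0 := fun x v w => by
    refine eq_of_inner_eq (g := g) fun z => ?_
    have h1 := hskew x v z w
    have h2 := hskew x z w v
    have h3 := hskew x w v z
    rw [hsymm x w v] at h2
    rw [hsymm x w z, hsymm x v z] at h3
    have h4 := g.symm x v (E x z w)
    have h5 := g.symm x z (E x v w)
    have h6 := g.symm x w (E x z v)
    simp only [map_zero, _root_.zero_apply]
    linarith
  intro Y x hY
  ext v : 1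
  have h := difference_apply L L' hY
  have h0 := hE x (Y x) v
  simp only [E, h, _root_.sub_apply] at h0
  exact sub_eq_zero.1 h0

end LeviCivita

/-! ### Conformal change of metric -/

section ConformalChange

theorem weylTensor_apply (g : Metric M) (θ : OneForm M) (x : M) (v w : TangentSpace (𝓡 2) x) :
    weylTensor g θ x v w = g.inner x v w • sharp g x (θ.toFun x) -
      (θ.toFun x v • w + θ.toFun x w • v) := rfl

theorem weylTensor_symm (g : Metric M) (θ : OneForm M) (x : M) (v w : TangentSpace (𝓡 2) x) :
    weylTensor g θ x v w = weylTensor g θ x w v := by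
  rw [weylTensor_apply, weylTensor_apply, g.symm x v w, add_comm]

theorem IsConformalChange.symm {g ghat : Metric M} {u : M → ℝ} (h : IsConformalChange g ghat u) :
    IsConformalChange ghat g (fun x => -u x) := fun x v w => by
  rw [h, ← mul_assoc, ← Real.exp_add]
  ring_nf
  simp

/-- The factor `e^{2u}` of the metric cancels against the factor `e^{-2u}` of `θ^♯`. -/
theorem IsConformalChange.weylTensor_eq {g ghat : Metric M} {u : M → ℝ}
    (h : IsConformalChange g ghat u) (θ : OneForm M) : weylTensor ghat θ = weylTensor g θ := by
  funext x
  ext v w : 2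
  have hs : sharp g x (θ.toFun x) = Real.exp (2 * u x) • sharp ghat x (θ.toFun x) :=
    Eq.symm <| eq_sharp_iff.2 fun z => by
      rw [map_smul, _root_.smul_apply, smul_eq_mul, ← h, inner_sharp]
  rw [weylTensor_apply, weylTensor_apply, hs, h, smul_smul, mul_comm]

/-- The correction is symmetric, so torsion stays zero. Differentiating `e^{2u} g` adds `2 du(X)
e^{2u} g`, which is what the `Sym(du)` terms supply; the remaining terms cancel in pairs. -/
theorem IsConformalChange.isLeviCivita {g ghat : Metric M} {u : M → ℝ}
    (h : IsConformalChange g ghat u) (hu : SmoothFun u) {L : Connection M}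
    (hL : IsLeviCivita g L) (du : OneForm M)
    (hdu : ∀ x v, du.toFun x v = mvfderiv (𝓡 2) u x v) :
    IsLeviCivita ghat (addEndForm L (-weylTensor g du)) := by
  rw [isLeviCivita_iff] at hL ⊢
  refine ⟨fun X Y x hX hY => ?_, fun X Y Z x hX hY hZ => ?_⟩
  · rw [← hL.1 X Y x hX hY]
    simp only [addEndForm_apply, Pi.neg_apply, LinearMap.neg_apply,
      weylTensor_symm g du x (X x) (Y x)]
    abel
  · have hgd : MDifferentiableAt (𝓡 2) 𝓘(ℝ, ℝ) (fun y => g.inner y (Y y) (Z y)) x := by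
      let _ : RiemannianBundle (fun x : M => TangentSpace (𝓡 2) x) := ⟨g.toRiemannianMetric⟩
      exact MDifferentiableAt.inner_bundle hY hZ
    have hud : MDifferentiableAt (𝓡 2) 𝓘(ℝ, ℝ) u x := (hu x).mdifferentiableAt (by simp)
    have hE : HasDerivAt (fun r : ℝ => Real.exp (2 * r)) (Real.exp (2 * u x) * (2 * 1)) (u x) :=
      ((hasDerivAt_id (u x)).const_mul 2).exp
    have hed : MDifferentiableAt (𝓡 2) 𝓘(ℝ, ℝ) (fun y => Real.exp (2 * u y)) x :=
      hE.differentiableAt.mdifferentiableAt.comp x hud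
    have hexp : mvfderiv (𝓡 2) (fun y => Real.exp (2 * u y)) x (X x) =
        2 * Real.exp (2 * u x) * mvfderiv (𝓡 2) u x (X x) := by
      have hc := mvfderiv_comp_apply (g := fun r : ℝ => Real.exp (2 * r)) (f := u) x
        hE.differentiableAt.mdifferentiableAt hud (X x)
      have hf : mvfderiv 𝓘(ℝ, ℝ) (fun r : ℝ => Real.exp (2 * r)) (u x) =
          fderiv ℝ (fun r : ℝ => Real.exp (2 * r)) (u x) := mfderiv_eq_fderiv
      rw [hf, hE.hasFDerivAt.fderiv] at hc
      refine hc.trans ?_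
      change mvfderiv (𝓡 2) u x (X x) * (Real.exp (2 * u x) * (2 * 1)) = _
      ring
    have h1 := hL.2 X Y Z x hX hY hZ
    simp only [h _]
    rw [mvfderiv_fun_mul hed hgd]
    simp only [_root_.add_apply, _root_.smul_apply, smul_eq_mul, hexp, h1]
    simp only [addEndForm_apply, Pi.neg_apply, LinearMap.neg_apply, weylTensor_apply, map_add,
      map_neg, map_sub, map_smul, _root_.add_apply, _root_.neg_apply, _root_.sub_apply,
      _root_.smul_apply, smul_eq_mul, inner_sharp, hdu]
    rw [g.symm x (Y x) (sharp g x (du.toFun x)), inner_sharp, hdu, g.symm x (Y x) (X x)]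
    ring

/-- The Weyl tensor is linear in `θ` and conformally invariant, so replacing the Levi-Civita
connection of `ghat` by that of `g` only shifts `θ` by `-du`. -/
theorem IsWeylConnectionOf.of_conformalChange {g ghat : Metric M} {u : M → ℝ}
    (h : IsConformalChange g ghat u) (hu : SmoothFun u) {θ : OneForm M} {D : Connection M}
    (hD : IsWeylConnectionOf ghat θ D) (du : OneForm M)
    (hdu : ∀ x v, du.toFun x v = mvfderiv (𝓡 2) u x v) (η : OneForm M)
    (hη : ∀ x, η.toFun x = θ.toFun x - du.toFun x) :
    IsWeylConnectionOf g η D := by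
  obtain ⟨L, hL, hDL⟩ := hD
  let ndu : OneForm M := ⟨fun x => -du.toFun x, fun X hX => (du.smooth X hX).neg⟩
  have hL' := h.symm.isLeviCivita hu.neg hL ndu fun x v => by
    simp only [ndu, LinearMap.neg_apply, hdu]
    have : mvfderiv (𝓡 2) (fun y => -u y) x = -mvfderiv (𝓡 2) u x := mvfderiv_neg
    rw [this]; rfl
  refine ⟨_, hL', hDL.trans fun Y x hY => ?_⟩
  ext v : 1
  have hs : sharp g x (θ.toFun x - du.toFun x) =
      sharp g x (θ.toFun x) - sharp g x (du.toFun x) := map_sub (flat g x).symm _ _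
  have hs' : sharp g x (-du.toFun x) = -sharp g x (du.toFun x) := map_neg (flat g x).symm _
  rw [h.weylTensor_eq, h.weylTensor_eq]
  simp only [addEndForm_apply, Pi.neg_apply, LinearMap.neg_apply, weylTensor_apply, hs, hs',
    hη, LinearMap.sub_apply, ndu]
  module

end ConformalChange

/-! ### Smoothness of the tensors of the construction -/

section Smoothness

/-- The field of bilinear maps `B` is smooth. -/
def SmoothEndForm (B : EndForm M) : Prop :=
  ∀ X Y : (x : M) → TangentSpace (𝓡 2) x, SmoothField X → SmoothField Y →
    SmoothField fun x => B x (X x) (Y x)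

theorem isSmooth_addEndForm [T2Space M] {D : Connection M} (hD : IsSmooth D) {B : EndForm M}
    (hB : SmoothEndForm B) : IsSmooth (addEndForm D B) :=
  isSmooth_of_apply fun X Y hX hY => (hD.apply hX hY).add (hB X Y hX hY)

theorem smoothFun_metricDerivative [T2Space M] {D : Connection M} (hD : IsSmooth D) (g : Metric M)
    {X Y Z : (x : M) → TangentSpace (𝓡 2) x} (hX : SmoothField X) (hY : SmoothField Y)
    (hZ : SmoothField Z) : SmoothFun fun x => metricDerivative D g x (X x) (Y x) (Z x) := by
  have h := (((hX.inner g hY).mvfderiv_apply hD g hZ).sub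
    ((hD.apply hZ hX).inner g hY)).sub (hX.inner g (hD.apply hZ hY))
  exact ContMDiff.congr h fun x =>
    metricDerivative_apply D g (hX.differentiableAt x) (hY.differentiableAt x) (Z x)

theorem smoothEndForm_leviCivitaForm [T2Space M] (o : SurfaceOrientation M) {D : Connection M}
    (hD : IsSmooth D) (g : Metric M) : SmoothEndForm (leviCivitaForm D g) := fun X Y hX hY =>
  smoothField_of_inner o g fun U hU => by
    simp only [inner_leviCivitaForm]
    exact contMDiff_const.mul (((smoothFun_metricDerivative hD g hY hU hX).add
      (smoothFun_metricDerivative hD g hX hU hY)).sub (smoothFun_metricDerivative hD g hX hY hU))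

theorem smoothEndForm_weylTensor [T2Space M] (o : SurfaceOrientation M) (g : Metric M)
    (θ : OneForm M) : SmoothEndForm (weylTensor g θ) := fun X Y hX hY =>
  ((SmoothField.sharp o g θ.smooth).smul (hX.inner g hY)).sub
    ((hY.smul (θ.smooth X hX)).add (hX.smul (θ.smooth Y hY)))

theorem SmoothEndForm.cubicPart {S : EndForm M} (hS : SmoothEndForm S) (o : SurfaceOrientation M)
    (g : Metric M) : SmoothEndForm (cubicPart o g S) := fun X Y hX hY => by
  have hJX := hX.rotation o g
  have hJY := hY.rotation o g
  simp only [cubicPart_apply]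
  exact SmoothField.const_smul _ (((hS X Y hX hY).sub (hS _ _ hJX hJY)).add
    (((hS _ _ hJX hY).add (hS _ _ hX hJY)).rotation o g))

theorem SmoothEndForm.weylPart [T2Space M] {S : EndForm M} (hS : SmoothEndForm S)
    (o : SurfaceOrientation M) (g : Metric M) {X : (x : M) → TangentSpace (𝓡 2) x}
    (hX : SmoothField X) : SmoothFun fun x => weylPart o g x S (X x) := by
  refine smoothFun_of_mul_inner g fun U hU => ?_
  have hJU := hU.rotation o g
  have h : SmoothFun fun x => weylPartAux o g x S (U x) (X x) := by
    simp only [weylPartAux_apply]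
    exact (contMDiff_const.mul (((hS U U hU hU).inner g hX).add
      ((hS _ _ hJU hJU).inner g hX))).sub (contMDiff_const.mul
      ((hU.inner g (hS X U hX hU)).add (hJU.inner g (hS _ _ hX hJU))))
  refine ContMDiff.congr h fun x => ?_
  by_cases hx : U x = 0
  · simp [hx, weylPartAux_apply]
  · rw [weylPart_apply o g x S hx, mul_div_cancel₀ _ (g.pos x _ hx).ne']

/-- The `1`-form `θ` for which `S` is projectively equivalent to `g ⊗ θ^♯ - Sym(θ)` up to a part
of cubic type. -/
def weylForm [T2Space M] (o : SurfaceOrientation M) (g : Metric M) {S : EndForm M}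
    (hS : SmoothEndForm S) : OneForm M where
  toFun x := weylPart o g x S
  smooth _ hX := hS.weylPart o g hX

/-- The differential of a smooth function. -/
def differentialForm [T2Space M] {D : Connection M} (hD : IsSmooth D) (g : Metric M) {u : M → ℝ}
    (hu : SmoothFun u) : OneForm M where
  toFun x := (mvfderiv (𝓡 2) u x).toLinearMap
  smooth _ hX := hu.mvfderiv_apply hD g hX

end Smoothness

/-! ### Tensors of cubic type as complex sections -/

section ComplexSections

theorem complexStructure_eq (o : SurfaceOrientation M) {c : ConformalStructure M} {g : Metric M}
    (hc : conformalClass g = c) (x : M) : complexStructure o c x = rotation o g x := by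
  subst hc; rfl

theorem rePart_I_smul {V : Type*} [AddCommGroup V] [Module ℝ V] (ξ : ℂ ⊗[ℝ] V) :
    rePart (Complex.I • ξ) = -imPart ξ := by
  induction ξ with
  | zero => simp
  | tmul z v => simp [rePart, imPart, TensorProduct.smul_tmul']
  | add a b ha hb => rw [smul_add, map_add, map_add, ha, hb]; abel

theorem rePart_lTensor {V : Type*} [AddCommGroup V] [Module ℝ V] (f : V →ₗ[ℝ] V) (ξ : ℂ ⊗[ℝ] V) :
    rePart (LinearMap.lTensor ℂ f ξ) = f (rePart ξ) := by
  induction ξ with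
  | zero => simp
  | tmul z v => simp [rePart]
  | add a b ha hb => rw [map_add, map_add, map_add, map_add, ha, hb]

theorem tmul_rePart_add_tmul_imPart {V : Type*} [AddCommGroup V] [Module ℝ V] (ξ : ℂ ⊗[ℝ] V) :
    (1 : ℂ) ⊗ₜ[ℝ] rePart ξ + Complex.I ⊗ₜ[ℝ] imPart ξ = ξ := by
  induction ξ with
  | zero => simp
  | tmul z v =>
    simp only [rePart, imPart, LinearMap.comp_apply, LinearMap.rTensor_tmul,
      LinearEquiv.coe_coe, TensorProduct.lid_tmul, Complex.reLm_coe, Complex.imLm_coe]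
    rw [← TensorProduct.smul_tmul, ← TensorProduct.smul_tmul, ← TensorProduct.add_tmul]
    congr 1
    apply Complex.ext <;> simp
  | add a b ha hb =>
    rw [map_add, map_add, TensorProduct.tmul_add, TensorProduct.tmul_add, add_add_add_comm, ha, hb]

theorem SmoothFun.complex_mk {f h : M → ℝ} (hf : SmoothFun f) (hh : SmoothFun h) :
    SmoothFun (fun x => (⟨f x, h x⟩ : ℂ)) := by
  have h1 : SmoothFun (fun x => f x • (1 : ℂ)) := ContMDiff.smul hf contMDiff_const
  have h2 : SmoothFun (fun x => h x • Complex.I) := ContMDiff.smul hh contMDiff_const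
  exact ContMDiff.congr (h1.add h2) fun x => by apply Complex.ext <;> simp

variable {o : SurfaceOrientation M} {c : ConformalStructure M} {g : Metric M}

theorem SectionK2KbarInv.re_apply (Φ : SectionK2KbarInv o c) (x : M)
    (v w : TangentSpace (𝓡 2) x) : Φ.re x v w = rePart (Φ.toFun x v w) := rfl

/-- The real part of `Jξ = -iξ` reads `J Re ξ = Im ξ`. Hence a section with values in `T^{0,1}M` is
determined by its real part. -/
theorem SectionK2KbarInv.imPart_apply (Φ : SectionK2KbarInv o c) (x : M)
    (v w : TangentSpace (𝓡 2) x) :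
    imPart (Φ.toFun x v w) = complexStructure o c x (Φ.re x v w) := by
  have h := congrArg rePart (Φ.antiholomorphic x v w)
  rw [rePart_lTensor, map_neg, rePart_I_smul, neg_neg] at h
  exact h.symm

theorem SectionK2KbarInv.isCubicTypeAt (hc : conformalClass g = c) (Φ : SectionK2KbarInv o c)
    (x : M) : IsCubicTypeAt o g x (Φ.re x) where
  left v w := by
    rw [← complexStructure_eq o hc, Φ.re_apply, Φ.linear₁, rePart_I_smul, Φ.imPart_apply]
  right v w := by
    rw [← complexStructure_eq o hc, Φ.re_apply, Φ.linear₂, rePart_I_smul, Φ.imPart_apply]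

theorem SectionK2KbarInv.eq_of_re_eq {Φ Ψ : SectionK2KbarInv o c} (h : Φ.re = Ψ.re) : Φ = Ψ := by
  ext x v w
  rw [← tmul_rePart_add_tmul_imPart (Φ.toFun x v w), ← tmul_rePart_add_tmul_imPart (Ψ.toFun x v w),
    Φ.imPart_apply, Ψ.imPart_apply, ← Φ.re_apply, ← Ψ.re_apply, h]

/-- Complex linearity lets `J` move from the first or second slot of `A` to the third, and `J` is
skew for `g`. -/
theorem cubicEndForm_isCubicTypeAt (hc : conformalClass g = c) (A : CubicDifferential o c) (x : M) :
    IsCubicTypeAt o g x (cubicEndForm g A x) where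
  left v w := eq_of_inner_eq (g := g) fun z => by
    rw [map_neg, _root_.neg_apply, inner_rotation_left, neg_neg, inner_cubicEndForm,
      inner_cubicEndForm, ← complexStructure_eq o hc, A.linear₁, A.linear₃]
  right v w := eq_of_inner_eq (g := g) fun z => by
    rw [map_neg, _root_.neg_apply, inner_rotation_left, neg_neg, inner_cubicEndForm,
      inner_cubicEndForm, ← complexStructure_eq o hc, A.linear₂, A.linear₃]

/-- The imaginary part is recovered from `Re A(Jv, w, z) = -Im A(v, w, z)`. -/
theorem CubicDifferential.eq_of_cubicEndForm_eq {A A' : CubicDifferential o c}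
    (h : cubicEndForm g A = cubicEndForm g A') : A = A' := by
  have hre : ∀ x v w z, (A.toFun x v w z).re = (A'.toFun x v w z).re := fun x v w z => by
    rw [← inner_cubicEndForm g, ← inner_cubicEndForm g, h]
  ext x v w z
  refine Complex.ext (hre x v w z) ?_
  have h1 := hre x (complexStructure o c x v) w z
  rw [A.linear₁, A'.linear₁] at h1
  simpa using h1

variable (g) in
/-- The section `B + i J B` of `K² ⊗ K̄⁻¹` with real part `B`. -/
def sectionOfCubicType (hc : conformalClass g = c) (B : EndForm M)
    (hB : ∀ x, IsCubicTypeAt o g x (B x)) (hs : SmoothEndForm B) : SectionK2KbarInv o c where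
  toFun x := (B x).compr₂ (TensorProduct.mk ℝ ℂ _ 1 +
    TensorProduct.mk ℝ ℂ _ Complex.I ∘ₗ rotation o g x)
  linear₁ x v w := by
    rw [complexStructure_eq o hc]
    simp only [LinearMap.compr₂_apply, (hB x).left, LinearMap.add_apply, LinearMap.comp_apply,
      TensorProduct.mk_apply, map_neg, rotation_rotation, smul_add, TensorProduct.smul_tmul',
      smul_eq_mul, mul_one, Complex.I_mul_I, TensorProduct.neg_tmul]
    abel
  linear₂ x v w := by
    rw [complexStructure_eq o hc]
    simp only [LinearMap.compr₂_apply, (hB x).right, LinearMap.add_apply, LinearMap.comp_apply,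
      TensorProduct.mk_apply, map_neg, rotation_rotation, smul_add, TensorProduct.smul_tmul',
      smul_eq_mul, mul_one, Complex.I_mul_I, TensorProduct.neg_tmul]
    abel
  antiholomorphic x v w := by
    rw [complexStructure_eq o hc]
    simp only [LinearMap.compr₂_apply, LinearMap.add_apply, LinearMap.comp_apply, map_add,
      TensorProduct.mk_apply, rotation_rotation, smul_add, TensorProduct.smul_tmul',
      LinearMap.lTensor_tmul, smul_eq_mul, mul_one, Complex.I_mul_I, TensorProduct.tmul_neg,
      TensorProduct.neg_tmul]
    abel
  smooth_re X Y hX hY := by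
    simpa [rePart] using hs X Y hX hY
  smooth_im X Y hX hY := by
    simpa [imPart] using (hs X Y hX hY).rotation o g

theorem sectionOfCubicType_re (hc : conformalClass g = c) (B : EndForm M)
    (hB : ∀ x, IsCubicTypeAt o g x (B x)) (hs : SmoothEndForm B) :
    (sectionOfCubicType g hc B hB hs).re = B := by
  funext x
  ext v w : 2
  rw [SectionK2KbarInv.re_apply]
  simp [sectionOfCubicType, rePart]

variable (o g) in
/-- The complex-valued bilinear form `(b, z) ↦ g(b, z) + i g(J b, z)`. -/
def hermitianForm (x : M) :
    TangentSpace (𝓡 2) x →ₗ[ℝ] TangentSpace (𝓡 2) x →ₗ[ℝ] ℂ :=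
  LinearMap.mk₂ ℝ (fun b z => (⟨g.inner x b z, g.inner x (rotation o g x b) z⟩ : ℂ))
    (fun _ _ _ => by apply Complex.ext <;> simp) (fun _ _ _ => by apply Complex.ext <;> simp)
    (fun _ _ _ => by apply Complex.ext <;> simp) (fun _ _ _ => by apply Complex.ext <;> simp)

theorem hermitianForm_apply (x : M) (b z : TangentSpace (𝓡 2) x) :
    hermitianForm o g x b z = ⟨g.inner x b z, g.inner x (rotation o g x b) z⟩ := rfl

/-- The form is conjugate linear in its first slot, which turns the antilinearity of `B` into
complex linearity of `A`. -/
theorem hermitianForm_neg_rotation_left (x : M) (b z : TangentSpace (𝓡 2) x) :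
    hermitianForm o g x (-rotation o g x b) z = Complex.I * hermitianForm o g x b z := by
  rw [hermitianForm_apply, hermitianForm_apply]
  apply Complex.ext <;> simp [rotation_rotation]

theorem hermitianForm_rotation_right (x : M) (b z : TangentSpace (𝓡 2) x) :
    hermitianForm o g x b (rotation o g x z) = Complex.I * hermitianForm o g x b z := by
  rw [hermitianForm_apply, hermitianForm_apply]
  apply Complex.ext <;> simp [inner_rotation_left, rotation_rotation]

variable (g) in
/-- The cubic differential `A` with `Re A(v₁, v₂, v₃) = g(B(v₁) v₂, v₃)`. -/
def cubicDifferentialOfCubicType (hc : conformalClass g = c) (B : EndForm M)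
    (hB : ∀ x, IsCubicTypeAt o g x (B x)) (hs : SmoothEndForm B) : CubicDifferential o c where
  toFun x := (B x).compr₂ (hermitianForm o g x)
  linear₁ x v w z := by
    rw [complexStructure_eq o hc, LinearMap.compr₂_apply, LinearMap.compr₂_apply, (hB x).left,
      hermitianForm_neg_rotation_left]
  linear₂ x v w z := by
    rw [complexStructure_eq o hc, LinearMap.compr₂_apply, LinearMap.compr₂_apply, (hB x).right,
      hermitianForm_neg_rotation_left]
  linear₃ x v w z := by
    rw [complexStructure_eq o hc, LinearMap.compr₂_apply, hermitianForm_rotation_right]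
  smooth X Y Z hX hY hZ := by
    have hB := hs X Y hX hY
    exact (hB.inner g hZ).complex_mk ((hB.rotation o g).inner g hZ)

theorem cubicEndForm_cubicDifferentialOfCubicType (hc : conformalClass g = c) (B : EndForm M)
    (hB : ∀ x, IsCubicTypeAt o g x (B x)) (hs : SmoothEndForm B) :
    cubicEndForm g (cubicDifferentialOfCubicType g hc B hB hs) = B := by
  funext x
  ext v w : 2
  refine eq_of_inner_eq (g := g) fun z => ?_
  rw [inner_cubicEndForm]
  rfl

end ComplexSections

/-! ### Regularity of solutions of autonomous equations -/

section Regularity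

/-- Bootstrapping: if `α` is of class `Cⁿ`, so is `α' = F ∘ α`, hence `α` is of class `Cⁿ⁺¹`. -/
theorem contDiffOn_of_hasDerivAt {E : Type*} [NormedAddCommGroup E] [NormedSpace ℝ E]
    {F : E → E} {s : Set E} (hF : ContDiffOn ℝ ∞ F s) {α : ℝ → E} {t : Set ℝ} (ht : IsOpen t)
    (hα : ∀ r ∈ t, HasDerivAt α (F (α r)) r) (hm : Set.MapsTo α t s) :
    ContDiffOn ℝ ∞ α t := by
  have hd : DifferentiableOn ℝ α t := fun r hr =>
    (hα r hr).differentiableAt.differentiableWithinAt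
  rw [contDiffOn_infty]
  intro n
  induction n with
  | zero => exact contDiffOn_zero.2 hd.continuousOn
  | succ n ih =>
    refine (contDiffOn_succ_iff_deriv_of_isOpen (n := (n : WithTop ℕ∞)) ht).2 ⟨hd, ?_, ?_⟩
    · intro h
      exact absurd h (WithTop.coe_ne_top)
    · refine ((hF.of_le (by exact_mod_cast le_top)).comp ih hm).congr fun r hr => ?_
      exact (hα r hr).deriv

end Regularity

/-! ### Covariant derivatives and accelerations in charts -/

section Charts

/-- The components of tangent vectors in the preferred chart at `p`. -/
abbrev chartComponents (p y : M) : TangentSpace (𝓡 2) y →L[ℝ] Plane :=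
  (trivializationAt Plane (fun x : M => TangentSpace (𝓡 2) x) p).continuousLinearMapAt ℝ y

/-- The tangent vector with given components in the preferred chart at `p`. -/
abbrev ofChartComponents (p y : M) : Plane →L[ℝ] TangentSpace (𝓡 2) y :=
  (trivializationAt Plane (fun x : M => TangentSpace (𝓡 2) x) p).symmL ℝ y

theorem chartComponents_eq {p y : M} (hy : y ∈ (chartAt Plane p).source) :
    chartComponents p y = mfderiv (𝓡 2) 𝓘(ℝ, Plane) (extChartAt (𝓡 2) p) y :=
  TangentBundle.continuousLinearMapAt_trivializationAt hy

theorem chartComponents_self (p : M) (v : TangentSpace (𝓡 2) p) :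
    chartComponents p p v = v := by
  rw [chartComponents_eq (mem_chart_source Plane p), mfderiv_extChartAt_self]
  rfl

theorem chartComponents_ofChartComponents {p y : M} (hy : y ∈ (chartAt Plane p).source)
    (z : Plane) : chartComponents p y (ofChartComponents p y z) = z :=
  (trivializationAt Plane (fun x : M => TangentSpace (𝓡 2) x) p).continuousLinearMapAt_symmL hy z

theorem ofChartComponents_chartComponents {p y : M} (hy : y ∈ (chartAt Plane p).source)
    (v : TangentSpace (𝓡 2) y) : ofChartComponents p y (chartComponents p y v) = v :=
  (trivializationAt Plane (fun x : M => TangentSpace (𝓡 2) x) p).symmL_continuousLinearMapAt hy v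

theorem chartComponents_apply {p y : M} (hy : y ∈ (chartAt Plane p).source)
    (v : TangentSpace (𝓡 2) y) : chartComponents p y v =
      (trivializationAt Plane (fun x : M => TangentSpace (𝓡 2) x) p ⟨y, v⟩).2 :=
  congrFun (Trivialization.coe_linearMapAt_of_mem (R := ℝ) _ hy) v

theorem extend_eq {p y : M} (hy : y ∈ (chartAt Plane p).source) (v : TangentSpace (𝓡 2) p) :
    FiberBundle.extend Plane v y = ofChartComponents p y (chartComponents p p v) := by
  rw [chartComponents_apply (mem_chart_source Plane p)]
  exact (Trivialization.symmL_apply (R := ℝ) _ hy _).symm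

theorem eventually_mem_chart_source (p : M) : ∀ᶠ y in 𝓝 p, y ∈ (chartAt Plane p).source :=
  (chartAt Plane p).open_source.mem_nhds (mem_chart_source Plane p)

theorem differentiableAt_ofChartComponents (p : M) (z : Plane) :
    DifferentiableFieldAt (fun y => ofChartComponents p y z) p := by
  refine MDifferentiableAt.congr_of_eventuallyEq
    (differentiableAt_extend (ofChartComponents p p z)) ?_
  filter_upwards [eventually_mem_chart_source p] with y hy
  rw [extend_eq hy, chartComponents_ofChartComponents (mem_chart_source Plane p)]

theorem SmoothField.chartComponents {X : (x : M) → TangentSpace (𝓡 2) x} (hX : SmoothField X)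
    (p : M) : ContMDiffOn (𝓡 2) 𝓘(ℝ, Plane) ∞
      (fun y => chartComponents p y (X y)) (chartAt Plane p).source := by
  have h := (Trivialization.contMDiffOn_section_baseSet_iff (IB := 𝓡 2) (n := ∞)
    (trivializationAt Plane (fun x : M => TangentSpace (𝓡 2) x) p)).1
    (ContMDiff.contMDiffOn (n := ∞) (s := (trivializationAt Plane
      (fun x : M => TangentSpace (𝓡 2) x) p).baseSet) hX)
  exact h.congr fun y hy => chartComponents_apply hy _

theorem DifferentiableFieldAt.chartComponents {X : (x : M) → TangentSpace (𝓡 2) x} {p : M}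
    (hX : DifferentiableFieldAt X p) :
    MDifferentiableAt (𝓡 2) 𝓘(ℝ, Plane) (fun y => chartComponents p y (X y)) p := by
  have h := ((mdifferentiableAt_totalSpace (IB := 𝓡 2) _).1 hX).2
  refine MDifferentiableAt.congr_of_eventuallyEq h ?_
  filter_upwards [eventually_mem_chart_source p] with y hy
  exact chartComponents_apply hy _

/-- A covariant derivative in the preferred chart: the derivative of the components plus the
derivative of the field with constant components. -/
theorem connection_eq_ofChartComponents (D : Connection M) {Y : (x : M) → TangentSpace (𝓡 2) x}
    {p : M} (hY : DifferentiableFieldAt Y p) (v : TangentSpace (𝓡 2) p) :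
    D Y p v = ofChartComponents p p
      (mvfderiv (𝓡 2) (fun y => chartComponents p y (Y y)) p v) +
      D (fun y => ofChartComponents p y (chartComponents p p (Y p))) p v := by
  have hcov := D.isCovariantDerivativeOnUniv
  have hsrc := eventually_mem_chart_source p
  let b := EuclideanSpace.basisFun (Fin 2) ℝ
  let E : Fin 2 → (x : M) → TangentSpace (𝓡 2) x := fun i y => ofChartComponents p y (b i)
  have hE : ∀ i, DifferentiableFieldAt (E i) p := fun i => differentiableAt_ofChartComponents p _
  have hsumE : ∀ (y : M) (z : Plane), ofChartComponents p y z = z 0 • E 0 y + z 1 • E 1 y := by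
    intro y z
    conv_lhs => rw [← b.sum_repr z]
    simp [E, b]
  -- Leibniz rule in the coordinate frame. It is used for `Y` and for the field with constant
  -- components equal to those of `Y` at `p`: the zeroth order terms agree, and the derivative term
  -- of the latter vanishes.
  have key : ∀ (Z : (x : M) → TangentSpace (𝓡 2) x), DifferentiableFieldAt Z p →
      D Z p v = ofChartComponents p p
        (mvfderiv (𝓡 2) (fun y => chartComponents p y (Z y)) p v) +
        (chartComponents p p (Z p) 0 • D (E 0) p v +
          chartComponents p p (Z p) 1 • D (E 1) p v) := by
    intro Z hZ
    have hc := hZ.chartComponents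
    let pr : Fin 2 → Plane →L[ℝ] ℝ := fun i =>
      EuclideanSpace.proj i
    have hpr : ∀ i z, MDifferentiableAt 𝓘(ℝ, Plane) 𝓘(ℝ, ℝ) (pr i) z := fun i z =>
      (pr i).differentiableAt.mdifferentiableAt
    have hci : ∀ i, MDifferentiableAt (𝓡 2) 𝓘(ℝ, ℝ) (fun y => chartComponents p y (Z y) i) p :=
      fun i => (hpr i _).comp p hc
    have hdi : ∀ i, mvfderiv (𝓡 2) (fun y => chartComponents p y (Z y) i) p v =
        mvfderiv (𝓡 2) (fun y => chartComponents p y (Z y)) p v i := by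
      intro i
      have h := mvfderiv_comp_apply (g := pr i) (f := fun y => chartComponents p y (Z y)) p
        (hpr i _) hc v
      refine h.trans ?_
      have hf : mvfderiv 𝓘(ℝ, Plane) (pr i) (chartComponents p p (Z p)) =
          fderiv ℝ (pr i) (chartComponents p p (Z p)) := mfderiv_eq_fderiv
      rw [hf, ContinuousLinearMap.fderiv]
      rfl
    have hterm : ∀ i, DifferentiableFieldAt ((fun y => chartComponents p y (Z y) i) • E i) p :=
      fun i => (hci i).smul_section (hE i)
    have hsum : D Z p = D ((fun y => chartComponents p y (Z y) 0) • E 0 +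
        (fun y => chartComponents p y (Z y) 1) • E 1) p := by
      refine hcov.congr_of_eventuallyEq hZ
        (mdifferentiableAt_add_section (hterm 0) (hterm 1)) Filter.univ_mem ?_
      filter_upwards [hsrc] with y hy
      exact (ofChartComponents_chartComponents hy (Z y)).symm.trans (hsumE y _)
    rw [hsum, hcov.add (hterm 0) (hterm 1), hcov.leibniz (hE 0) (hci 0),
      hcov.leibniz (hE 1) (hci 1), hsumE]
    simp only [_root_.add_apply, _root_.smul_apply, ContinuousLinearMap.smulRight_apply, hdi]
    module
  have hY' := key Y hY
  have hconst := key (fun y => ofChartComponents p y (chartComponents p p (Y p)))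
    (differentiableAt_ofChartComponents p _)
  have hz : mvfderiv (𝓡 2) (fun y => chartComponents p y (ofChartComponents p y
      (chartComponents p p (Y p)))) p v = 0 := by
    have he : (fun y => chartComponents p y (ofChartComponents p y (chartComponents p p (Y p))))
        =ᶠ[𝓝 p] fun _ => chartComponents p p (Y p) := by
      filter_upwards [hsrc] with y hy
      rw [chartComponents_ofChartComponents hy]
    have hc := mvfderiv_const (I := 𝓡 2) (x := p) (chartComponents p p (Y p))
    have hm := he.mfderiv_eq (I := 𝓡 2) (I' := 𝓘(ℝ, Plane))
    have hm' := congrArg (fun L : Plane →L[ℝ] Plane => L v) hm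
    have hc' := congrArg (fun L : Plane →L[ℝ] Plane => L v) hc
    exact hm'.trans hc'
  rw [hz, map_zero, zero_add, chartComponents_ofChartComponents (mem_chart_source Plane p)]
    at hconst
  rw [hY', hconst]

/-- The covariant acceleration of an integral curve of the field `Y` is `D_Y Y`. -/
theorem acceleration_eq_of_velocity_eq (D : Connection M) {γ : ℝ → M} {t : ℝ}
    {Y : (x : M) → TangentSpace (𝓡 2) x} (hY : DifferentiableFieldAt Y (γ t))
    (hγ : ∀ᶠ s in 𝓝 t, MDifferentiableAt 𝓘(ℝ, ℝ) (𝓡 2) γ s ∧ velocity γ s = Y (γ s)) :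
    acceleration D γ t = D Y (γ t) (Y (γ t)) := by
  have hγt := hγ.self_of_nhds
  have hsrc : ∀ᶠ s in 𝓝 t, γ s ∈ (chartAt Plane (γ t)).source :=
    hγt.1.continuousAt.eventually
      ((chartAt Plane (γ t)).open_source.mem_nhds (mem_chart_source Plane (γ t)))
  have hd : (deriv fun s => extChartAt (𝓡 2) (γ t) (γ s)) =ᶠ[𝓝 t]
      fun s => chartComponents (γ t) (γ s) (Y (γ s)) := by
    filter_upwards [hγ, hsrc] with s ⟨hs, hv⟩ hms
    rw [← hv, chartComponents_eq hms]
    have hc := mfderiv_comp_apply (I := 𝓘(ℝ, ℝ)) (I' := 𝓡 2) (I'' := 𝓘(ℝ, Plane)) s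
      (mdifferentiableAt_extChartAt (I := 𝓡 2) hms) hs (1 : ℝ)
    rw [mfderiv_eq_fderiv] at hc
    exact hc
  have hdd : deriv (deriv fun s => extChartAt (𝓡 2) (γ t) (γ s)) t =
      mvfderiv (𝓡 2) (fun y => chartComponents (γ t) y (Y y)) (γ t) (velocity γ t) := by
    rw [hd.deriv_eq]
    have hc := mfderiv_comp_apply (I := 𝓘(ℝ, ℝ)) (I' := 𝓡 2) (I'' := 𝓘(ℝ, Plane)) t
      hY.chartComponents hγt.1 (1 : ℝ)
    rw [mfderiv_eq_fderiv] at hc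
    exact hc
  -- At the centre of its preferred chart the trivialization is the identity of the model plane, so
  -- the second derivative in the chart is already a tangent vector.
  have hself : ∀ z : Plane, (ofChartComponents (γ t) (γ t) z : Plane) = z := fun z => by
    have h := chartComponents_ofChartComponents (mem_chart_source Plane (γ t)) z
    rwa [chartComponents_self] at h
  rw [connection_eq_ofChartComponents D hY, ← hγt.2]
  have hext : D (FiberBundle.extend Plane (velocity γ t)) (γ t) = D (fun y =>
      ofChartComponents (γ t) y (chartComponents (γ t) (γ t) (velocity γ t))) (γ t) := by
    refine D.isCovariantDerivativeOnUniv.congr_of_eventuallyEq (differentiableAt_extend _)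
      (differentiableAt_ofChartComponents _ _) Filter.univ_mem ?_
    filter_upwards [eventually_mem_chart_source (γ t)] with y hy
    exact extend_eq hy _
  rw [acceleration, hext]
  congr 1
  exact hdd.trans (hself _).symm

end Charts

/-! ### Existence of unparametrised geodesics -/

section Geodesics

/-- A second order ordinary differential equation for a curve whose velocity has constant component
`1` along `v`. -/
theorem exists_curve_of_contDiffOn {E : Type*} [NormedAddCommGroup E] [NormedSpace ℝ E]
    [CompleteSpace E] {s : Set E} (hs : IsOpen s) {z : E} (hz : z ∈ s) {v w : E} {l : E →L[ℝ] ℝ}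
    (hv : l v = 1) (hw : l w = 0) {h : E × ℝ → ℝ}
    (hh : ContDiffOn ℝ ∞ h (s ×ˢ Set.univ)) :
    ∃ (ε : ℝ) (α : ℝ → E) (q : ℝ → ℝ), 0 < ε ∧ α 0 = z ∧ q 0 = 0 ∧
      ContDiffOn ℝ ∞ α (Set.Ioo (-ε) ε) ∧
      ∀ t ∈ Set.Ioo (-ε) ε, α t ∈ s ∧ HasDerivAt α (v + q t • w) t ∧
        HasDerivAt q (h (α t, q t)) t ∧ l (α t) = l z + t := by
  have hs' : IsOpen (s ×ˢ (Set.univ : Set ℝ)) := hs.prod isOpen_univ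
  -- First order system for the pair `(α, q)`: `α' = v + q w`, `q' = h(α, q)`.
  have hF : ContDiffOn ℝ ∞ (fun y : E × ℝ => (v + y.2 • w, h y)) (s ×ˢ Set.univ) :=
    (contDiffOn_const.add (contDiff_snd.contDiffOn.smul contDiffOn_const)).prodMk hh
  obtain ⟨β, hβ, ε, hε, hd⟩ :=
    ((hF.contDiffAt (hs'.mem_nhds (x := (z, (0 : ℝ))) ⟨hz, trivial⟩)).of_le
      (by exact_mod_cast le_top :
        (1 : WithTop ℕ∞) ≤ ∞)).exists_forall_mem_closedBall_exists_eq_forall_mem_Ioo_hasDerivAt₀ 0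
  simp only [zero_sub, zero_add] at hd
  have hcont : ContinuousAt β 0 := (hd 0 ⟨neg_lt_zero.2 hε, hε⟩).continuousAt
  have hnear : ∀ᶠ t in 𝓝 (0 : ℝ), β t ∈ s ×ˢ (Set.univ : Set ℝ) :=
    hcont.eventually (hs'.mem_nhds (by rw [hβ]; exact ⟨hz, trivial⟩))
  obtain ⟨δ, hδ, hball⟩ := Metric.eventually_nhds_iff_ball.1 hnear
  rw [Real.ball_eq_Ioo] at hball
  simp only [zero_sub, zero_add] at hball
  have hsub : ∀ t ∈ Set.Ioo (-min ε δ) (min ε δ), t ∈ Set.Ioo (-ε) ε ∧ t ∈ Set.Ioo (-δ) δ := by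
    intro t ht
    have h1 := min_le_left ε δ
    have h2 := min_le_right ε δ
    exact ⟨⟨by linarith [ht.1], by linarith [ht.2]⟩, by linarith [ht.1], by linarith [ht.2]⟩
  have hβd : ∀ t ∈ Set.Ioo (-min ε δ) (min ε δ),
      HasDerivAt β (v + (β t).2 • w, h (β t)) t := fun t ht => hd t (hsub t ht).1
  have hβs : Set.MapsTo β (Set.Ioo (-min ε δ) (min ε δ)) (s ×ˢ Set.univ) :=
    fun t ht => hball t (hsub t ht).2
  have hβ1 : ∀ t ∈ Set.Ioo (-min ε δ) (min ε δ),
      HasDerivAt (fun t => (β t).1) (v + (β t).2 • w) t := fun t ht =>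
    (hasFDerivAt_fst.comp_hasDerivAt t (hβd t ht) :)
  have hmin : 0 < min ε δ := lt_min hε hδ
  refine ⟨min ε δ, fun t => (β t).1, fun t => (β t).2, hmin, by simp [hβ],
    by simp [hβ], contDiff_fst.comp_contDiffOn (contDiffOn_of_hasDerivAt hF isOpen_Ioo hβd hβs),
    fun t ht => ⟨(hβs ht).1, hβ1 t ht, (hasFDerivAt_snd.comp_hasDerivAt t (hβd t ht) :), ?_⟩⟩
  -- The derivative of `l ∘ α` is `l(v) + q l(w) = 1`, so `l` measures time along the curve.
  have hl : ∀ t ∈ Set.Ioo (-min ε δ) (min ε δ),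
      HasDerivAt (fun t => l (β t).1 - t) 0 t := by
    intro t ht
    have := (l.hasFDerivAt.comp_hasDerivAt t (hβ1 t ht)).sub (hasDerivAt_id t)
    rw [map_add, map_smul, hv, hw, smul_zero, add_zero, sub_self] at this
    exact this
  have := isOpen_Ioo.is_const_of_deriv_eq_zero isPreconnected_Ioo
    (fun t ht => (hl t ht).differentiableAt.differentiableWithinAt)
    (fun t ht => (hl t ht).deriv) ht (show (0 : ℝ) ∈ Set.Ioo (-min ε δ) (min ε δ) from
      ⟨neg_lt_zero.2 hmin, hmin⟩)
  simp only [hβ, sub_zero] at this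
  linarith

/-- The frame of the plane made of a nonzero vector and its rotation, with its coordinates. -/
theorem exists_frame_of_ne_zero {v : Plane} (hv : v ≠ 0) :
    ∃ (w : Plane) (l m : Plane →L[ℝ] ℝ), l v = 1 ∧ l w = 0 ∧ ∀ z, z = l z • v + m z • w := by
  let pr : Fin 2 → Plane →L[ℝ] ℝ := fun i => EuclideanSpace.proj i
  have hpr : ∀ i z, pr i z = z i := fun _ _ => rfl
  have hN : v 0 ^ 2 + v 1 ^ 2 ≠ 0 := by
    intro h
    apply hv
    ext i
    fin_cases i
    · change v 0 = 0
      nlinarith [sq_nonneg (v 0), sq_nonneg (v 1)]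
    · change v 1 = 0
      nlinarith [sq_nonneg (v 0), sq_nonneg (v 1)]
  refine ⟨!₂[-v 1, v 0], (v 0 ^ 2 + v 1 ^ 2)⁻¹ • (v 0 • pr 0 + v 1 • pr 1),
    (v 0 ^ 2 + v 1 ^ 2)⁻¹ • (v 0 • pr 1 - v 1 • pr 0), ?_, ?_, fun z => ?_⟩
  · simp only [_root_.smul_apply, _root_.add_apply, hpr, smul_eq_mul]
    field_simp
  · simp only [_root_.smul_apply, _root_.add_apply, hpr, smul_eq_mul]
    simp
    right; ring
  · ext i
    fin_cases i
    · simp [hpr]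
      field_simp
      ring
    · simp [hpr]
      field_simp
      ring

/-- Components of a smooth field in the preferred chart, as a function of the coordinates. -/
theorem SmoothField.contDiffOn_components {X : (x : M) → TangentSpace (𝓡 2) x}
    (hX : SmoothField X) (p : M) :
    ContDiffOn ℝ ∞ (fun z => WeylProjective.chartComponents p ((extChartAt (𝓡 2) p).symm z)
      (X ((extChartAt (𝓡 2) p).symm z))) (extChartAt (𝓡 2) p).target := by
  rw [← contMDiffOn_iff_contDiffOn]
  refine (hX.chartComponents p).comp (contMDiffOn_extChartAt_symm p) fun z hz => ?_
  have := (extChartAt (𝓡 2) p).map_target hz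
  rwa [extChartAt_source] at this

theorem exists_smoothField_eq_ofChartComponents [T2Space M] (p : M) (z : Plane) :
    ∃ U : (x : M) → TangentSpace (𝓡 2) x, SmoothField U ∧
      ∀ᶠ y in 𝓝 p, U y = ofChartComponents p y z := by
  obtain ⟨U, hU, h⟩ := exists_smoothField_eq_extend p (ofChartComponents p p z)
  refine ⟨U, hU, ?_⟩
  filter_upwards [h, eventually_mem_chart_source p] with y hy hys
  rw [hy, extend_eq hys, chartComponents_ofChartComponents (mem_chart_source Plane p)]

theorem connection_add_smul (D : Connection M) {U W : (x : M) → TangentSpace (𝓡 2) x} {x : M}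
    (hU : DifferentiableFieldAt U x) (hW : DifferentiableFieldAt W x) {q : M → ℝ}
    (hq : MDifferentiableAt (𝓡 2) 𝓘(ℝ, ℝ) q x) (v : TangentSpace (𝓡 2) x) :
    D (fun y => U y + q y • W y) x v =
      D U x v + q x • D W x v + mvfderiv (𝓡 2) q x v • W x := by
  have h1 := D.isCovariantDerivativeOnUniv.add hU (hq.smul_section hW : DifferentiableFieldAt _ x)
  have h2 := D.isCovariantDerivativeOnUniv.leibniz hW hq
  have h3 : D (fun y => U y + q y • W y) x = D U x + D (q • W) x := h1
  rw [h3, h2]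
  simp only [_root_.add_apply, _root_.smul_apply, ContinuousLinearMap.smulRight_apply]
  module

/-- The freedom of parametrisation allows a velocity of the form `U + q W`, where `U`, `W` have
constant components `v`, `w` in the chart. Only the scalar `q` remains to be found. The conclusion
is stated in the total space because `γ 0 = x₀` is not definitional. -/
theorem exists_isUnparametrizedGeodesic_ofChartComponents [T2Space M] {D : Connection M}
    (hD : IsSmooth D) (x₀ : M) {v : Plane} (hv : v ≠ 0) :
    ∃ (γ : ℝ → M) (a b : ℝ), a < 0 ∧ 0 < b ∧ IsUnparametrizedGeodesic D γ a b ∧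
      TotalSpace.mk' Plane (E := fun x : M => TangentSpace (𝓡 2) x) (γ 0) (velocity γ 0) =
        TotalSpace.mk' Plane x₀ (ofChartComponents x₀ x₀ v) := by
  obtain ⟨w, l, m, hlv, hlw, hlm⟩ := exists_frame_of_ne_zero hv
  obtain ⟨U, hU, hUe⟩ := exists_smoothField_eq_ofChartComponents x₀ v
  obtain ⟨W, hW, hWe⟩ := exists_smoothField_eq_ofChartComponents x₀ w
  obtain ⟨N, hN, hNo, hxN⟩ := mem_nhds_iff.1 (hUe.and hWe)
  set φ := extChartAt (𝓡 2) x₀ with hφ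
  set s : Set Plane := φ.target ∩ φ.symm ⁻¹' N with hs
  have hso : IsOpen s := (continuousOn_extChartAt_symm x₀).isOpen_inter_preimage
    (isOpen_extChartAt_target x₀) hNo
  have hx₀ : φ.symm (φ x₀) = x₀ := extChartAt_to_inv x₀
  have hz : φ x₀ ∈ s := ⟨mem_extChartAt_target x₀, by rwa [Set.mem_preimage, hx₀]⟩
  let k : ((x : M) → TangentSpace (𝓡 2) x) → Plane → Plane := fun X z =>
    chartComponents x₀ (φ.symm z) (X (φ.symm z))
  have hk : ∀ (X : (x : M) → TangentSpace (𝓡 2) x), SmoothField X →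
      ContDiffOn ℝ ∞ (fun y : Plane × ℝ => k X y.1) (s ×ˢ Set.univ) := fun X hX =>
    ((hX.contDiffOn_components x₀).mono Set.inter_subset_left).comp contDiff_fst.contDiffOn
      fun y hy => hy.1
  -- Components of `D_Y Y` for `Y = U + q W` with `q` held constant.
  let H : Plane × ℝ → Plane := fun y => k (fun x => D U x (U x)) y.1 +
    y.2 • k (fun x => D U x (W x) + D W x (U x)) y.1 + (y.2 * y.2) • k (fun x => D W x (W x)) y.1
  have hsnd : ContDiffOn ℝ ∞ (fun y : Plane × ℝ => y.2) (s ×ˢ Set.univ) := contDiff_snd.contDiffOn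
  have hH : ContDiffOn ℝ ∞ H (s ×ˢ Set.univ) :=
    ((hk _ (hD.apply hU hU)).add (hsnd.smul (hk _ ((hD.apply hW hU).add (hD.apply hU hW))))).add
      ((hsnd.mul hsnd).smul (hk _ (hD.apply hW hW)))
  -- Along the curve `D_Y Y = l(H) U + (m(H) + q') W`. It is a multiple of `U + q W` when the factor
  -- is `l(H)` and `q' = q l(H) - m(H)`.
  obtain ⟨ε, α, q, hε, hα0, hq0, hα, hsol⟩ := exists_curve_of_contDiffOn hso hz hlv hlw
    (h := fun y => y.2 * l (H y) - m (H y))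
    ((hsnd.mul (l.contDiff.comp_contDiffOn hH)).sub (m.contDiff.comp_contDiffOn hH))
  have hα' : ∀ t ∈ Set.Ioo (-ε) ε, α t ∈ φ.target := fun t ht => (hsol t ht).1.1
  let γ : ℝ → M := fun t => φ.symm (α t)
  have hγ : ContMDiffOn 𝓘(ℝ, ℝ) (𝓡 2) ∞ γ (Set.Ioo (-ε) ε) :=
    (contMDiffOn_extChartAt_symm x₀).comp (contMDiffOn_iff_contDiffOn.2 hα) hα'
  have hγd : ∀ t ∈ Set.Ioo (-ε) ε, MDifferentiableAt 𝓘(ℝ, ℝ) (𝓡 2) γ t := fun t ht =>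
    (hγ.contMDiffAt (isOpen_Ioo.mem_nhds ht)).mdifferentiableAt (by simp)
  have hsrc : ∀ t ∈ Set.Ioo (-ε) ε, γ t ∈ (chartAt Plane x₀).source := fun t ht => by
    have := φ.map_target (hα' t ht)
    rwa [hφ, extChartAt_source] at this
  have hφγ : ∀ t ∈ Set.Ioo (-ε) ε, φ (γ t) = α t := fun t ht => φ.right_inv (hα' t ht)
  have hUγ : ∀ t ∈ Set.Ioo (-ε) ε, U (γ t) = ofChartComponents x₀ (γ t) v := fun t ht =>
    (hN (hsol t ht).1.2).1
  have hWγ : ∀ t ∈ Set.Ioo (-ε) ε, W (γ t) = ofChartComponents x₀ (γ t) w := fun t ht =>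
    (hN (hsol t ht).1.2).2
  have hvel : ∀ t ∈ Set.Ioo (-ε) ε, velocity γ t = U (γ t) + q t • W (γ t) := by
    intro t ht
    have hc := mfderiv_comp_apply (I := 𝓘(ℝ, ℝ)) (I' := 𝓡 2) (I'' := 𝓘(ℝ, Plane)) t
      (mdifferentiableAt_extChartAt (I := 𝓡 2) (hsrc t ht)) (hγd t ht) (1 : ℝ)
    have he : (extChartAt (𝓡 2) x₀ ∘ γ) =ᶠ[𝓝 t] α := by
      filter_upwards [isOpen_Ioo.mem_nhds ht] with r hr
      exact hφγ r hr
    rw [mfderiv_eq_fderiv, he.fderiv_eq, ← chartComponents_eq (hsrc t ht)] at hc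
    have hd : chartComponents x₀ (γ t) (velocity γ t) = v + q t • w :=
      hc.symm.trans (hsol t ht).2.1.deriv
    rw [← ofChartComponents_chartComponents (hsrc t ht) (velocity γ t), hd, map_add, map_smul,
      hUγ t ht, hWγ t ht]
  -- Since `l` measures time, `q` extends from the curve to a function on `M`. The velocity is then
  -- the restriction of the field `U + qf W`, and the acceleration is a covariant derivative of that
  -- field.
  let qf : M → ℝ := fun y => q (l (φ y) - l (φ x₀))
  have hlt : ∀ t ∈ Set.Ioo (-ε) ε, l (φ (γ t)) - l (φ x₀) = t := fun t ht => by
    rw [hφγ t ht, (hsol t ht).2.2.2]; ring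
  have hqf : ∀ t ∈ Set.Ioo (-ε) ε, qf (γ t) = q t := fun t ht => congrArg q (hlt t ht)
  have h0 : (0 : ℝ) ∈ Set.Ioo (-ε) ε := ⟨neg_lt_zero.2 hε, hε⟩
  refine ⟨γ, -ε, ε, neg_lt_zero.2 hε, hε, ⟨hγ, ?_, fun t => l (H (α t, q t)), ?_⟩, ?_⟩
  · intro t ht h
    have h1 := congrArg (chartComponents x₀ (γ t)) (h.symm.trans (hvel t ht))
    rw [map_zero, map_add, map_smul, hUγ t ht, hWγ t ht,
      chartComponents_ofChartComponents (hsrc t ht),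
      chartComponents_ofChartComponents (hsrc t ht)] at h1
    have h2 := congrArg l h1
    simp [hlv, hlw] at h2
  · intro t ht
    have hqd : MDifferentiableAt (𝓡 2) 𝓘(ℝ, ℝ) qf (γ t) := by
      have h1 : DifferentiableAt ℝ q (l (φ (γ t)) - l (φ x₀)) := by
        rw [hlt t ht]; exact (hsol t ht).2.2.1.differentiableAt
      have h2 : MDifferentiableAt (𝓡 2) 𝓘(ℝ, ℝ) (fun y => l (φ y) - l (φ x₀)) (γ t) :=
        MDifferentiableAt.sub (l.differentiableAt.mdifferentiableAt.comp (γ t)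
          (mdifferentiableAt_extChartAt (hsrc t ht))) mdifferentiableAt_const
      exact h1.mdifferentiableAt.comp (γ t) h2
    have hY : DifferentiableFieldAt (fun y => U y + qf y • W y) (γ t) :=
      mdifferentiableAt_add_section (hU.differentiableAt _)
        (hqd.smul_section (hW.differentiableAt _))
    have hacc := acceleration_eq_of_velocity_eq D hY (by
      filter_upwards [isOpen_Ioo.mem_nhds ht] with r hr
      exact ⟨hγd r hr, by rw [hvel r hr, hqf r hr]⟩)
    have hdq : mvfderiv (𝓡 2) qf (γ t) (velocity γ t) =
        q t * l (H (α t, q t)) - m (H (α t, q t)) := by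
      have hc := mfderiv_comp_apply (I := 𝓘(ℝ, ℝ)) (I' := 𝓡 2) (I'' := 𝓘(ℝ, ℝ)) t
        hqd (hγd t ht) (1 : ℝ)
      have he : (qf ∘ γ) =ᶠ[𝓝 t] q := by
        filter_upwards [isOpen_Ioo.mem_nhds ht] with r hr
        exact hqf r hr
      rw [mfderiv_eq_fderiv, he.fderiv_eq] at hc
      exact hc.symm.trans (hsol t ht).2.2.1.deriv
    rw [hacc, connection_add_smul D (hU.differentiableAt _) (hW.differentiableAt _) hqd, hqf t ht,
      ← hvel t ht, hdq, hvel t ht, map_add, map_add, map_smul, map_smul]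
    have hcomp : ofChartComponents x₀ (γ t) (H (α t, q t)) = D U (γ t) (U (γ t)) +
        q t • (D U (γ t) (W (γ t)) + D W (γ t) (U (γ t))) +
          (q t * q t) • D W (γ t) (W (γ t)) := by
      simp only [H, k, map_add, map_smul]
      simp only [← map_add]
      rw [ofChartComponents_chartComponents (hsrc t ht),
        ofChartComponents_chartComponents (hsrc t ht),
        ofChartComponents_chartComponents (hsrc t ht)]
    have hdec : ofChartComponents x₀ (γ t) (H (α t, q t)) =
        l (H (α t, q t)) • U (γ t) + m (H (α t, q t)) • W (γ t) := by
      rw [hUγ t ht, hWγ t ht, ← map_smul, ← map_smul, ← map_add]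
      exact congrArg _ (hlm _)
    rw [hcomp] at hdec
    rw [← sub_eq_zero] at hdec ⊢
    rw [← hdec]
    module
  · have hγ0 : γ 0 = x₀ := by rw [show γ 0 = φ.symm (α 0) from rfl, hα0, hx₀]
    rw [hvel 0 h0, hq0, zero_smul, add_zero]
    rw [hγ0, (hN hxN).1]

theorem exists_isUnparametrizedGeodesic [T2Space M] {D : Connection M} (hD : IsSmooth D) (x₀ : M)
    {v : TangentSpace (𝓡 2) x₀} (hv : v ≠ 0) :
    ∃ (γ : ℝ → M) (a b : ℝ), a < 0 ∧ 0 < b ∧ IsUnparametrizedGeodesic D γ a b ∧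
      TotalSpace.mk' Plane (E := fun x : M => TangentSpace (𝓡 2) x) (γ 0) (velocity γ 0) =
        TotalSpace.mk' Plane x₀ v := by
  have hs := mem_chart_source Plane x₀
  have hv' : chartComponents x₀ x₀ v ≠ 0 := fun h => hv <| by
    rw [← ofChartComponents_chartComponents hs v, h, map_zero]
  obtain ⟨γ, a, b, ha, hb, hγ, h⟩ := exists_isUnparametrizedGeodesic_ofChartComponents hD x₀ hv'
  rw [ofChartComponents_chartComponents hs] at h
  exact ⟨γ, a, b, ha, hb, hγ, h⟩

end Geodesics

/-! ### Projective equivalence and uniqueness -/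

section Projective

/-- The second derivatives in the chart cancel, so only the connection terms at the given velocity
remain. -/
theorem acceleration_sub (D D' : Connection M) (γ : ℝ → M) (t : ℝ) :
    acceleration D γ t - acceleration D' γ t =
      D (FiberBundle.extend Plane (velocity γ t)) (γ t) (velocity γ t) -
        D' (FiberBundle.extend Plane (velocity γ t)) (γ t) (velocity γ t) :=
  add_sub_add_left_eq_sub _ _ _

theorem IsUnparametrizedGeodesic.of_forall_exists_smul {D D' : Connection M}
    (h : ∀ (x : M) (v : TangentSpace (𝓡 2) x), ∃ r : ℝ, D (FiberBundle.extend Plane v) x v -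
      D' (FiberBundle.extend Plane v) x v = r • v) {γ : ℝ → M} {a b : ℝ}
    (hγ : IsUnparametrizedGeodesic D γ a b) : IsUnparametrizedGeodesic D' γ a b := by
  obtain ⟨h1, h2, f, hf⟩ := hγ
  choose r hr using h
  refine ⟨h1, h2, fun t => f t - r (γ t) (velocity γ t), fun t ht => ?_⟩
  rw [sub_smul, ← hr, ← acceleration_sub, hf t ht]
  abel

theorem ProjectivelyEquivalent.of_forall_exists_smul {D D' : Connection M}
    (h : ∀ (x : M) (v : TangentSpace (𝓡 2) x), ∃ r : ℝ, D (FiberBundle.extend Plane v) x v -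
      D' (FiberBundle.extend Plane v) x v = r • v) : ProjectivelyEquivalent D D' :=
  fun _ _ _ => ⟨fun hγ => hγ.of_forall_exists_smul h, fun hγ => hγ.of_forall_exists_smul
    fun x v => by
      obtain ⟨r, hr⟩ := h x v
      exact ⟨-r, by rw [neg_smul, ← hr, neg_sub]⟩⟩

/-- Projectively equivalent connections differ by a multiple of `v` in the direction of every
vector `v`. -/
theorem ProjectivelyEquivalent.exists_smul [T2Space M] {D D' : Connection M}
    (h : ProjectivelyEquivalent D D') (hD' : IsSmooth D') (x : M) (v : TangentSpace (𝓡 2) x) :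
    ∃ r : ℝ, D (FiberBundle.extend Plane v) x v -
      D' (FiberBundle.extend Plane v) x v = r • v := by
  by_cases hv : v = 0
  · exact ⟨0, by simp [hv]⟩
  obtain ⟨γ, a, b, ha, hb, hγ, heq⟩ := exists_isUnparametrizedGeodesic hD' x hv
  obtain ⟨-, -, k, hk⟩ := (h γ a b).2 hγ
  obtain ⟨-, -, f, hf⟩ := hγ
  have hP : ∃ r : ℝ, D (FiberBundle.extend Plane (velocity γ 0)) (γ 0) (velocity γ 0) -
      D' (FiberBundle.extend Plane (velocity γ 0)) (γ 0) (velocity γ 0) = r • velocity γ 0 :=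
    ⟨k 0 - f 0, by rw [← acceleration_sub, hk 0 ⟨ha, hb⟩, hf 0 ⟨ha, hb⟩, sub_smul]⟩
  -- Phrasing the claim as a predicate on the total space allows it to be transported from `(γ 0,
  -- γ'(0))` to `(x, v)`.
  let P : TotalSpace Plane (fun x : M => TangentSpace (𝓡 2) x) → Prop := fun p =>
    ∃ r : ℝ, D (FiberBundle.extend Plane p.2) p.1 p.2 -
      D' (FiberBundle.extend Plane p.2) p.1 p.2 = r • p.2
  have hP' : P (TotalSpace.mk' Plane (γ 0) (velocity γ 0)) := hP
  rw [heq] at hP'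
  exact hP'

variable {o : SurfaceOrientation M} {g : Metric M}

/-- The difference of the two connections at `(v, v)` is a multiple of `v` exactly when it is
orthogonal to `Jv`. Pairing with `Jv` annihilates `Sym(θ)(v, v) = 2θ(v)v` and leaves an equation of
cubic forms at each point. -/
theorem projectivelyEquivalent_iff [T2Space M] (o : SurfaceOrientation M) {nabla D : Connection M}
    (hsmooth : IsSmooth nabla) (htorsion : nabla.torsion = 0) {θ : OneForm M}
    (hD : IsWeylConnectionOf g θ D) (B : EndForm M) :
    ProjectivelyEquivalent (addEndForm D B) nabla ↔
      ∀ (x : M) (v : TangentSpace (𝓡 2) x),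
        g.inner x v v * θ.toFun x (rotation o g x v) +
          g.inner x (rotation o g x v) (B x v v) =
        g.inner x (rotation o g x v) ((-leviCivitaForm nabla g) x v v) := by
  obtain ⟨L, hL, hDL⟩ := hD
  have hdiff : ∀ (x : M) (v : TangentSpace (𝓡 2) x),
      addEndForm D B (FiberBundle.extend Plane v) x v - nabla (FiberBundle.extend Plane v) x v =
        leviCivitaForm nabla g x v v + weylTensor g θ x v v + B x v v := by
    intro x v
    have hv := differentiableAt_extend v
    rw [addEndForm_apply, hDL _ x hv, addEndForm_apply,
      hL.unique (isLeviCivita_leviCivita htorsion g) _ x hv, leviCivita, addEndForm_apply,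
      FiberBundle.extend_apply_self]
    abel
  have hinner : ∀ (x : M) (v : TangentSpace (𝓡 2) x), g.inner x (rotation o g x v)
      (leviCivitaForm nabla g x v v + weylTensor g θ x v v + B x v v) =
      g.inner x v v * θ.toFun x (rotation o g x v) + g.inner x (rotation o g x v) (B x v v) -
        g.inner x (rotation o g x v) ((-leviCivitaForm nabla g) x v v) := by
    intro x v
    have h1 : g.inner x (rotation o g x v) (sharp g x (θ.toFun x)) =
        θ.toFun x (rotation o g x v) := by rw [g.symm, inner_sharp]
    have h2 : (-leviCivitaForm nabla g) x v v = -leviCivitaForm nabla g x v v := rfl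
    rw [h2, weylTensor_apply]
    simp only [map_add, map_sub, map_smul, map_neg, inner_rotation_self, h1, smul_eq_mul]
    ring
  constructor
  · intro h x v
    obtain ⟨r, hr⟩ := h.exists_smul hsmooth x v
    rw [← sub_eq_zero, ← hinner, ← hdiff, hr, map_smul, inner_rotation_self, smul_zero]
  · intro h
    refine ProjectivelyEquivalent.of_forall_exists_smul fun x v => ?_
    by_cases hv : v = 0
    · exact ⟨0, by simp [hv]⟩
    · rw [hdiff]
      exact exists_smul_of_inner_rotation o g x hv (by rw [hinner, h, sub_self])

theorem IsCubicTypeAt.sub {x : M}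
    {B B' : TangentSpace (𝓡 2) x →ₗ[ℝ] TangentSpace (𝓡 2) x →ₗ[ℝ] TangentSpace (𝓡 2) x}
    (hB : IsCubicTypeAt o g x B) (hB' : IsCubicTypeAt o g x B') : IsCubicTypeAt o g x (B - B') where
  left v w := by
    simp only [LinearMap.sub_apply, hB.left, hB'.left, map_sub]
    abel
  right v w := by
    simp only [LinearMap.sub_apply, hB.right, hB'.right, map_sub]
    abel

/-- A Weyl connection and a form of cubic type are determined by the projective class of their
sum. -/
theorem eq_of_projectivelyEquivalent [T2Space M] {nabla D D' : Connection M}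
    (hsmooth : IsSmooth nabla) (htorsion : nabla.torsion = 0) {θ θ' : OneForm M}
    (hD : IsWeylConnectionOf g θ D) (hD' : IsWeylConnectionOf g θ' D') {B B' : EndForm M}
    (hB : ∀ x, IsCubicTypeAt o g x (B x)) (hB' : ∀ x, IsCubicTypeAt o g x (B' x))
    (h : ProjectivelyEquivalent (addEndForm D B) nabla)
    (h' : ProjectivelyEquivalent (addEndForm D' B') nabla) : θ = θ' ∧ B = B' := by
  rw [projectivelyEquivalent_iff o hsmooth htorsion hD] at h
  rw [projectivelyEquivalent_iff o hsmooth htorsion hD'] at h'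
  have key : ∀ x, θ.toFun x - θ'.toFun x = 0 ∧ B x - B' x = 0 := fun x =>
    eq_zero_of_cubic_add_linear o g x _ ((hB x).sub (hB' x)) _ fun v => by
      simp only [LinearMap.sub_apply, map_sub]
      linear_combination h x v - h' x v
  exact ⟨OneForm.ext (funext fun x => sub_eq_zero.1 (key x).1),
    funext fun x => sub_eq_zero.1 (key x).2⟩

theorem IsWeylConnectionOf.addEndForm_weylTensor {L : Connection M} (hL : IsLeviCivita g L)
    (θ : OneForm M) : IsWeylConnectionOf g θ (addEndForm L (weylTensor g θ)) :=
  ⟨L, hL, fun _ _ _ => rfl⟩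

theorem IsWeylConnectionOf.sameConnection {θ : OneForm M} {D D' : Connection M}
    (hD : IsWeylConnectionOf g θ D) (hD' : IsWeylConnectionOf g θ D') : SameConnection D D' := by
  obtain ⟨L, hL, h⟩ := hD
  obtain ⟨L', hL', h'⟩ := hD'
  exact (h.trans ((hL.unique hL').addEndForm _)).trans h'.symm

/-- The difference of two `1`-forms. -/
def OneForm.sub (θ η : OneForm M) : OneForm M where
  toFun x := θ.toFun x - η.toFun x
  smooth X hX := (θ.smooth X hX).sub (η.smooth X hX)

/-- A Weyl connection can be written with respect to any prescribed metric of the class, so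
uniqueness may be tested with one fixed `g`. -/
theorem IsWeylConnection.exists_isWeylConnectionOf [T2Space M] {nabla : Connection M}
    (hsmooth : IsSmooth nabla) {c : ConformalStructure M} (hc : conformalClass g = c)
    {D : Connection M} (hD : IsWeylConnection c D) : ∃ θ : OneForm M, IsWeylConnectionOf g θ D := by
  obtain ⟨-, ghat, hghat, θ, hθ⟩ := hD
  obtain ⟨u, hu, h⟩ := Quotient.exact (hc.trans hghat.symm)
  exact ⟨θ.sub (differentialForm hsmooth g hu),
    hθ.of_conformalChange h hu _ (fun _ _ => rfl) _ fun _ => rfl⟩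

variable {nabla : Connection M} {c : ConformalStructure M}

theorem Represents.exists_isWeylConnectionOf {θ : OneForm M} {A : CubicDifferential o c}
    (h : Represents nabla g θ A) : ∃ D : Connection M, IsWeylConnectionOf g θ D ∧
      ProjectivelyEquivalent (addEndForm D (cubicEndForm g A)) nabla := by
  obtain ⟨L, hL, h⟩ := h
  exact ⟨_, IsWeylConnectionOf.addEndForm_weylTensor hL θ, h⟩

theorem Represents.eq [T2Space M] (hsmooth : IsSmooth nabla) (htorsion : nabla.torsion = 0)
    (hc : conformalClass g = c) {θ θ' : OneForm M} {A A' : CubicDifferential o c}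
    (h : Represents nabla g θ A) (h' : Represents nabla g θ' A') : θ = θ' ∧ A = A' := by
  obtain ⟨D, hD, hp⟩ := h.exists_isWeylConnectionOf
  obtain ⟨D', hD', hp'⟩ := h'.exists_isWeylConnectionOf
  have := eq_of_projectivelyEquivalent hsmooth htorsion hD hD' (cubicEndForm_isCubicTypeAt hc A)
    (cubicEndForm_isCubicTypeAt hc A') hp hp'
  exact ⟨this.1, CubicDifferential.eq_of_cubicEndForm_eq this.2⟩

/-- A Weyl connection in the projective class of `nabla`, up to a form of cubic type. -/
theorem exists_projectivelyEquivalent [T2Space M] (o : SurfaceOrientation M)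
    (hsmooth : IsSmooth nabla) (htorsion : nabla.torsion = 0) (g : Metric M) :
    ∃ (θ : OneForm M) (B : EndForm M), SmoothEndForm B ∧ (∀ x, IsCubicTypeAt o g x (B x)) ∧
      ProjectivelyEquivalent (addEndForm (addEndForm (leviCivita nabla g) (weylTensor g θ)) B)
        nabla := by
  have hS : SmoothEndForm (-leviCivitaForm nabla g) := fun X Y hX hY =>
    (smoothEndForm_leviCivitaForm o hsmooth g X Y hX hY).neg
  refine ⟨weylForm o g hS, cubicPart o g (-leviCivitaForm nabla g), hS.cubicPart o g,
    fun x => isCubicTypeAt_cubicPart o g x _, ?_⟩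
  rw [projectivelyEquivalent_iff o hsmooth htorsion
    (IsWeylConnectionOf.addEndForm_weylTensor (isLeviCivita_leviCivita htorsion g) _)]
  exact fun x v => inner_weylPart_add_cubicPart o g x _
    (fun v w => congrArg Neg.neg (leviCivitaForm_symm nabla g x v w)) v

/-- How the representation of a projective structure depends on the metric of the conformal
class. -/
theorem Represents.conformalChange [T2Space M] (hsmooth : IsSmooth nabla)
    (htorsion : nabla.torsion = 0) (hc : conformalClass g = c) {ghat : Metric M} {u : M → ℝ}
    (hu : SmoothFun u) (hg : IsConformalChange g ghat u) {θ thetahat : OneForm M}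
    {A Ahat : CubicDifferential o c} (h : Represents nabla g θ A)
    (hhat : Represents nabla ghat thetahat Ahat) (x : M) :
    (∀ v₁ v₂ v₃ : TangentSpace (𝓡 2) x,
      Ahat.toFun x v₁ v₂ v₃ = (Real.exp (2 * u x) : ℂ) * A.toFun x v₁ v₂ v₃) ∧
    ∀ v : TangentSpace (𝓡 2) x, thetahat.toFun x v = θ.toFun x v + mvfderiv (𝓡 2) u x v := by
  obtain ⟨D, hD, hp⟩ := h.exists_isWeylConnectionOf
  obtain ⟨Dhat, hDhat, hphat⟩ := hhat.exists_isWeylConnectionOf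
  have hchat : conformalClass ghat = c := by
    rw [← hc]
    exact (Quotient.sound ⟨u, hu, hg⟩ : conformalClass g = conformalClass ghat).symm
  -- Both representations are now compared over the same metric `g`, where uniqueness applies.
  have hDhat' := hDhat.of_conformalChange hg hu (differentialForm hsmooth g hu)
    (fun _ _ => rfl) (thetahat.sub (differentialForm hsmooth g hu)) fun _ => rfl
  have hBhat : ∀ y, IsCubicTypeAt o g y (cubicEndForm ghat Ahat y) := fun y => by
    have h := cubicEndForm_isCubicTypeAt hchat Ahat y
    constructor
    · rw [rotation_eq_of_conformal o hg]
      exact h.left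
    · rw [rotation_eq_of_conformal o hg]
      exact h.right
  obtain ⟨h1, h2⟩ := eq_of_projectivelyEquivalent hsmooth htorsion hDhat' hD hBhat
    (cubicEndForm_isCubicTypeAt hc A) hphat hp
  have hre : ∀ v₁ v₂ v₃ : TangentSpace (𝓡 2) x,
      (Ahat.toFun x v₁ v₂ v₃).re = Real.exp (2 * u x) * (A.toFun x v₁ v₂ v₃).re :=
    fun v₁ v₂ v₃ => by
      rw [← inner_cubicEndForm ghat, ← inner_cubicEndForm g, h2, hg]
  refine ⟨fun v₁ v₂ v₃ => Complex.ext ?_ ?_, fun v => ?_⟩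
  · rw [Complex.re_ofReal_mul, hre]
  -- The imaginary parts follow from the real parts at `Jv₁`.
  · have h3 := hre (complexStructure o c x v₁) v₂ v₃
    rw [A.linear₁, Ahat.linear₁, Complex.I_mul_re, Complex.I_mul_re] at h3
    rw [Complex.im_ofReal_mul]
    linarith
  · rw [← h1]
    exact (sub_add_cancel (thetahat.toFun x v) (mvfderiv (𝓡 2) u x v)).symm

end Projective

end WeylProjective

end

open WeylProjective

/-! ### The theorem -/

theorem proposition3 {M : Type*} [TopologicalSpace M] [ChartedSpace Plane M]
    [IsManifold (𝓡 2) ∞ M] [T2Space M] [SigmaCompactSpace M] [ConnectedSpace M]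
    (o : SurfaceOrientation M)
    (nabla : Connection M) (hsmooth : IsSmooth nabla)
    (htorsion : nabla.torsion = 0) (c : ConformalStructure M) :
    ∃ (D : Connection M) (Φ : SectionK2KbarInv o c),
      IsWeylConnection c D ∧
      ProjectivelyEquivalent (addEndForm D Φ.re) nabla ∧
      (∀ (D' : Connection M) (Φ' : SectionK2KbarInv o c),
        IsWeylConnection c D' →
        ProjectivelyEquivalent (addEndForm D' Φ'.re) nabla →
        SameConnection D' D ∧ Φ' = Φ) ∧
      (∀ g : Metric M, conformalClass g = c →
        ∃ (θ : OneForm M) (A : CubicDifferential o c),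
          Represents nabla g θ A ∧
          (∀ (θ' : OneForm M) (A' : CubicDifferential o c),
            Represents nabla g θ' A' → θ' = θ ∧ A' = A) ∧
          IsWeylConnectionOf g θ D ∧
          Φ.re = cubicEndForm g A) ∧
      (∀ (g ghat : Metric M) (u : M → ℝ), conformalClass g = c →
        SmoothFun u → IsConformalChange g ghat u →
        ∀ (θ thetahat : OneForm M) (A Ahat : CubicDifferential o c),
          Represents nabla g θ A →
          Represents nabla ghat thetahat Ahat →
          ∀ (x : M),
            (∀ v₁ v₂ v₃ : TangentSpace (𝓡 2) x,
              Ahat.toFun x v₁ v₂ v₃ = (Real.exp (2 * u x) : ℂ) * A.toFun x v₁ v₂ v₃) ∧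
            (∀ v : TangentSpace (𝓡 2) x,
              thetahat.toFun x v = θ.toFun x v + mvfderiv (𝓡 2) u x v)) := by
  obtain ⟨g, hg⟩ : ∃ g : Metric M, conformalClass g = c := Quotient.exists_rep c
  obtain ⟨θ, B, hBs, hB, hp⟩ := exists_projectivelyEquivalent o hsmooth htorsion g
  set D := addEndForm (leviCivita nabla g) (weylTensor g θ) with hDdef
  have hD : IsWeylConnectionOf g θ D :=
    IsWeylConnectionOf.addEndForm_weylTensor (isLeviCivita_leviCivita htorsion g) θ
  have hDs : IsSmooth D := isSmooth_addEndForm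
    (isSmooth_addEndForm hsmooth (smoothEndForm_leviCivitaForm o hsmooth g))
    (smoothEndForm_weylTensor o g θ)
  have hDW : IsWeylConnection c D := ⟨hDs, g, hg, θ, hD⟩
  have hΦ := sectionOfCubicType_re hg B hB hBs
  refine ⟨D, sectionOfCubicType g hg B hB hBs, hDW, by rwa [hΦ], fun D' Φ' hD' hp' => ?_,
    fun g' hg' => ?_, fun g' ghat u hg' hu h θ' thetahat A Ahat hA hAhat x =>
      hA.conformalChange hsmooth htorsion hg' hu h hAhat x⟩
  -- Uniqueness of `(D, Φ)`: `D'` may come from another metric of the class, and is rewritten over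
  -- `g` before comparison.
  · obtain ⟨θ', hθ'⟩ := hD'.exists_isWeylConnectionOf hsmooth hg
    obtain ⟨rfl, h2⟩ := eq_of_projectivelyEquivalent hsmooth htorsion hθ' hD
      (Φ'.isCubicTypeAt hg) hB hp' hp
    exact ⟨hθ'.sameConnection hD, SectionK2KbarInv.eq_of_re_eq (h2.trans hΦ.symm)⟩
  · obtain ⟨θ', B', hBs', hB', hp'⟩ := exists_projectivelyEquivalent o hsmooth htorsion g'
    have hA := cubicEndForm_cubicDifferentialOfCubicType hg' B' hB' hBs'
    have hL' := isLeviCivita_leviCivita htorsion g'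
    have hrep : Represents nabla g' θ' (cubicDifferentialOfCubicType g' hg' B' hB' hBs') :=
      ⟨_, hL', by rwa [hA]⟩
    -- `D` is rewritten over `g'`. Since `D + Re Φ` and the connection built from `g'` are both
    -- projectively equivalent to `nabla`, uniqueness identifies the forms and the cubic parts.
    obtain ⟨η, hη⟩ := hDW.exists_isWeylConnectionOf hsmooth hg'
    have hB'' := (sectionOfCubicType g hg B hB hBs).isCubicTypeAt hg'
    rw [hΦ] at hB''
    obtain ⟨rfl, h2⟩ := eq_of_projectivelyEquivalent hsmooth htorsion hη
      (IsWeylConnectionOf.addEndForm_weylTensor hL' θ') hB'' hB' hp hp'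
    exact ⟨η, _, hrep, fun θ'' A'' h'' => h''.eq hsmooth htorsion hg' hrep, hη,
      by rw [hΦ, hA, h2]⟩
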